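/- Let $n$ agents and $m$ items be given, and let the utilities $u_i(j)$, for $i\in\{1,\dots,n\}$ and $j\in\{1,\dots,m\}$, be drawn independently from a fixed probability distribution $\mathcal D$ supported on $[0,1]$; utilities are additive, $u_i(S)=\sum_{j\in S}u_i(j)$. Call $\mathcal D$ *PDF-bounded* if it has a density $f$ such that $\alpha\le f(x)\le\beta$ for all $x\in[0,1]$, for some constants $\alpha,\beta>0$. In the *round-robin algorithm* the agents take turns in the order $1,2,\dots,n,1,2,\dots$, each picking a favorite item among the remaining ones (ties, which have probability $0$, are broken towards the smallest index), until the items run out. An allocation (partition of the set $M$ of all items) $(M_1,\dots,M_n)$ is *proportional* if $u_i(M_i)\ge u_i(M)/n$ for every $i$. (a) Suppose that $\mathcal D$ is PDF-bounded and has mean at most $1/2$. Then for every $\varepsilon>0$ there is an $n_0$ (depending only on $\mathcal D$ and $\varepsilon$) such that for all $n\ge n_0$ and all $m\ge 2n$, the round-robin algorithm outputs a proportional allocation with probability at least $1-\varepsilon$. (b) The uniform distribution $U[0,1]$ is PDF-bounded with mean $1/2$, so (a) applies to it. (c) The bound $m\ge 2n$ in (a) is tight: there is a constant $c>0$ such that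 for $\mathcal D=U[0,1]$, every $n\ge2$ and $m=2n-1$, the allocation output by the round-robin algorithm fails to be proportional with probability at least $c$. -/

import Mathlib

open MeasureTheory

namespace FairDivision

/-- `D` is a probability distribution supported on `[0, 1]` which has a density `f` (so that it is
in particular non-atomic) with `α ≤ f ≤ β` on `[0, 1]`. -/
structure IsPDFBoundedWith (α β : ℝ) (D : Measure ℝ) : Prop where
  isProbabilityMeasure : IsProbabilityMeasure D
  supported : D (Set.Icc 0 1)ᶜ = 0
  exists_pdf : ∃ f : ℝ → ℝ, Measurable f ∧ (∀ x, 0 ≤ f x) ∧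
    D = volume.withDensity (fun x => ENNReal.ofReal (f x)) ∧
    ∀ x ∈ Set.Icc (0 : ℝ) 1, α ≤ f x ∧ f x ≤ β

/-- `D` is PDF-bounded: it is `(α, β)`-PDF-bounded for some `α, β > 0`. -/
def IsPDFBounded (D : Measure ℝ) : Prop :=
  ∃ α β : ℝ, 0 < α ∧ 0 < β ∧ IsPDFBoundedWith α β D

/-- The uniform distribution `U[0,1]`. -/
noncomputable def uniform01 : Measure ℝ := volume.restrict (Set.Icc 0 1)

/-- The joint law of the utilities `u i j` of `n` agents for `m` items, when these are drawn
independently from `D`. -/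
noncomputable def utilityLaw (D : Measure ℝ) (n m : ℕ) : Measure (Fin n → Fin m → ℝ) :=
  Measure.pi fun _ : Fin n => Measure.pi fun _ : Fin m => D

/-- An allocation: the bundles `A i` partition the set of items (bundles may be empty). -/
def IsAllocation {n m : ℕ} (A : Fin n → Finset (Fin m)) : Prop :=
  (∀ i i', i ≠ i' → Disjoint (A i) (A i')) ∧ ∀ j, ∃ i, j ∈ A i

/-- Proportionality, for additive utilities: `u_i(M_i) ≥ u_i(M) / n` for every agent `i`. -/
def IsProportional {n m : ℕ} (u : Fin n → Fin m → ℝ) (A : Fin n → Finset (Fin m)) : Prop :=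
  ∀ i, (∑ j, u i j) / (n : ℝ) ≤ ∑ j ∈ A i, u i j

theorem exists_favorite {m : ℕ} (v : Fin m → ℝ) (S : Finset (Fin m)) (hS : S.Nonempty) :
    {j ∈ S | ∀ k ∈ S, v k ≤ v j}.Nonempty := by
  obtain ⟨j, hj, h⟩ := S.exists_max_image v hS
  exact ⟨j, Finset.mem_filter.2 ⟨hj, h⟩⟩

/-- The favorite item in `S` of an agent with utilities `v`: an item of maximum utility
(ties are broken in favor of the smallest index). -/
noncomputable def favorite {m : ℕ} (v : Fin m → ℝ) (S : Finset (Fin m)) (hS : S.Nonempty) :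
    Fin m :=
  {j ∈ S | ∀ k ∈ S, v k ≤ v j}.min' (exists_favorite v S hS)

/-- The state of the round-robin algorithm: the remaining items and the bundles built so far. -/
structure RRState (n m : ℕ) where
  remaining : Finset (Fin m)
  bundle : Fin n → Finset (Fin m)

/-- Agent `i` takes her favorite item among the remaining items, if there are any. -/
noncomputable def takeTurn {n m : ℕ} (u : Fin n → Fin m → ℝ) (i : Fin n) (s : RRState n m) :
    RRState n m :=
  if h : s.remaining.Nonempty then
    { remaining := s.remaining.erase (favorite (u i) s.remaining h)
      bundle := Function.update s.bundle i
        (insert (favorite (u i) s.remaining h) (s.bundle i)) }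
  else s

/-- The state after `t` turns; turn `t` (counted from `0`) belongs to agent `t mod n`, so that
the picking order is `0, 1, …, n - 1, 0, 1, …`. -/
noncomputable def rrState {n m : ℕ} [NeZero n] (u : Fin n → Fin m → ℝ) : ℕ → RRState n m
  | 0 => { remaining := Finset.univ, bundle := fun _ => ∅ }
  | t + 1 => takeTurn u (Fin.ofNat n t) (rrState u t)

/-- The output of the round-robin algorithm: the bundles after `m` turns, when the `m` items have
run out. -/
noncomputable def roundRobin {n m : ℕ} [NeZero n] (u : Fin n → Fin m → ℝ) :
    Fin n → Finset (Fin m) :=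
  (rrState u m).bundle

end FairDivision

/-! Let F be the distribution function of D. By Hoeffding, every agent values the set of all items
below m(1/2 + δ), except with probability at most n·exp(-2δ²m), so it suffices that each bundle is
worth (m/n)(1/2 + δ) to its owner. Each pick is at least as good as anything left at that time or
later. Hence a single good item remaining before an agent's turn t (counted from 0) makes her first
t + 1 picks good.

The core is a tail bound: the r items left before turn t are all worth less than y to the agent with
probability at most exp(t + r/n)·F(y)^r (`utilityLaw_remainingItems_lt_le`). The remaining set
depends on her utilities, so one conditions on the other agents. From her viewpoint a round then
removes her favorite and afterwards n - 1 items that are a function of what remains.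
`pi_iterate_lt_le` peels off one round at a time: a union bound over the favorite, integration over
its value, and ∫ F^k dF ≤ F^(k+1)/(k+1) produce factors (r + sn)/(sn), whose product is at most
exp(t + r/n).

If r is at least of order n and of order tn, then y = 1 - δ gives a bound exponentially small in n,
which survives the union over agents. If m is barely above 2n, or 3n ≤ m < 4n, one further pick
worth only 8δ closes the gap. For agent i at least n - i items remain before that pick, so the
failure probabilities sum like a geometric series, of size O(δ) because the density is bounded.

For tightness, with m = 2n - 1 the last agent gets at most one item, while her expected total is n -
1/2, and it exceeds n with constant probability. -/

namespace FairDivision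

/-! ### Round-robin as a deterministic process -/

section Deterministic

variable {n m : ℕ}

/-- The items that remain in `S` after an agent with utilities `v` has taken her favorite. -/
noncomputable def removeFavorite (v : Fin m → ℝ) (S : Finset (Fin m)) : Finset (Fin m) :=
  if h : S.Nonempty then S.erase (favorite v S h) else S

theorem favorite_spec (v : Fin m → ℝ) (S : Finset (Fin m)) (hS : S.Nonempty) :
    favorite v S hS ∈ S ∧ ∀ k ∈ S, v k ≤ v (favorite v S hS) :=
  Finset.mem_filter.1 (Finset.min'_mem _ (exists_favorite v S hS))

theorem favorite_congr {v w : Fin m → ℝ} {S : Finset (Fin m)} (hS : S.Nonempty)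
    (h : ∀ k ∈ S, v k = w k) : favorite v S hS = favorite w S hS := by
  unfold favorite
  congr 1
  refine Finset.filter_congr fun j hj => forall₂_congr fun k hk => ?_
  rw [h j hj, h k hk]

theorem removeFavorite_subset (v : Fin m → ℝ) (S : Finset (Fin m)) : removeFavorite v S ⊆ S := by
  unfold removeFavorite
  split_ifs
  · exact Finset.erase_subset _ _
  · exact subset_rfl

theorem card_removeFavorite (v : Fin m → ℝ) (S : Finset (Fin m)) :
    (removeFavorite v S).card = S.card - 1 := by
  unfold removeFavorite
  split_ifs with h
  · exact Finset.card_erase_of_mem (favorite_spec v S h).1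
  · simp [Finset.not_nonempty_iff_eq_empty.1 h]

theorem removeFavorite_congr {v w : Fin m → ℝ} {S : Finset (Fin m)}
    (h : ∀ k ∈ S, v k = w k) : removeFavorite v S = removeFavorite w S := by
  unfold removeFavorite
  split_ifs with hS
  · rw [favorite_congr hS h]
  · rfl

theorem takeTurn_remaining (u : Fin n → Fin m → ℝ) (i : Fin n) (s : RRState n m) :
    (takeTurn u i s).remaining = removeFavorite (u i) s.remaining := by
  unfold takeTurn removeFavorite
  split_ifs <;> rfl

theorem takeTurn_bundle_of_ne (u : Fin n → Fin m → ℝ) {i i' : Fin n} (h : i' ≠ i)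
    (s : RRState n m) : (takeTurn u i s).bundle i' = s.bundle i' := by
  unfold takeTurn
  split_ifs
  · simp [h]
  · rfl

theorem takeTurn_bundle_self (u : Fin n → Fin m → ℝ) (i : Fin n) (s : RRState n m)
    (h : s.remaining.Nonempty) :
    (takeTurn u i s).bundle i = insert (favorite (u i) s.remaining h) (s.bundle i) := by
  simp [takeTurn, h]

theorem subset_takeTurn_bundle (u : Fin n → Fin m → ℝ) (i i' : Fin n) (s : RRState n m) :
    s.bundle i' ⊆ (takeTurn u i s).bundle i' := by
  by_cases h : i' = i
  · subst h
    by_cases hs : s.remaining.Nonempty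
    · rw [takeTurn_bundle_self u i' s hs]
      exact Finset.subset_insert _ _
    · simp [takeTurn, hs]
  · rw [takeTurn_bundle_of_ne u h]

theorem card_takeTurn_bundle_le (u : Fin n → Fin m → ℝ) (i i' : Fin n) (s : RRState n m) :
    ((takeTurn u i s).bundle i').card ≤ (s.bundle i').card + 1 := by
  by_cases h : i' = i
  · subst h
    by_cases hs : s.remaining.Nonempty
    · rw [takeTurn_bundle_self u i' s hs]
      exact Finset.card_insert_le _ _
    · simp [takeTurn, hs]
  · rw [takeTurn_bundle_of_ne u h]
    omega

variable [NeZero n]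

/-- The items that remain after `t` turns of the round-robin algorithm. -/
noncomputable def remainingItems (u : Fin n → Fin m → ℝ) (t : ℕ) : Finset (Fin m) :=
  (rrState u t).remaining

@[simp]
theorem remainingItems_zero (u : Fin n → Fin m → ℝ) : remainingItems u 0 = Finset.univ := rfl

theorem remainingItems_succ (u : Fin n → Fin m → ℝ) (t : ℕ) :
    remainingItems u (t + 1) = removeFavorite (u (Fin.ofNat n t)) (remainingItems u t) :=
  takeTurn_remaining _ _ _

theorem card_remainingItems (u : Fin n → Fin m → ℝ) (t : ℕ) :
    (remainingItems u t).card = m - t := by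
  induction t with
  | zero => simp
  | succ t ih =>
    rw [remainingItems_succ, card_removeFavorite, ih]
    omega

theorem remainingItems_antitone (u : Fin n → Fin m → ℝ) : Antitone (remainingItems u) :=
  antitone_nat_of_succ_le fun t => by
    rw [remainingItems_succ]
    exact removeFavorite_subset _ _

theorem rrState_bundle_mono (u : Fin n → Fin m → ℝ) (i : Fin n) :
    Monotone fun t => (rrState u t).bundle i :=
  monotone_nat_of_le_succ fun _ => subset_takeTurn_bundle _ _ _ _

theorem rrState_invariant (u : Fin n → Fin m → ℝ) (t : ℕ) :
    (∀ i, Disjoint ((rrState u t).bundle i) (rrState u t).remaining) ∧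
    (∀ i i', i ≠ i' → Disjoint ((rrState u t).bundle i) ((rrState u t).bundle i')) ∧
    ∀ j, j ∈ (rrState u t).remaining ∨ ∃ i, j ∈ (rrState u t).bundle i := by
  induction t with
  | zero => simp [rrState]
  | succ t ih =>
    obtain ⟨h1, h2, h3⟩ := ih
    change (∀ i, Disjoint ((takeTurn u (Fin.ofNat n t) (rrState u t)).bundle i)
        (takeTurn u (Fin.ofNat n t) (rrState u t)).remaining) ∧
      (∀ i i', i ≠ i' → Disjoint ((takeTurn u (Fin.ofNat n t) (rrState u t)).bundle i)
        ((takeTurn u (Fin.ofNat n t) (rrState u t)).bundle i')) ∧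
      ∀ j, j ∈ (takeTurn u (Fin.ofNat n t) (rrState u t)).remaining ∨
        ∃ i, j ∈ (takeTurn u (Fin.ofNat n t) (rrState u t)).bundle i
    generalize rrState u t = s at h1 h2 h3 ⊢
    generalize Fin.ofNat n t = a
    by_cases hs : s.remaining.Nonempty
    swap
    · simpa [takeTurn, hs] using ⟨h1, h2, h3⟩
    have hf := (favorite_spec (u a) s.remaining hs).1
    have hb : ∀ i, (takeTurn u a s).bundle i =
        if i = a then insert (favorite (u a) s.remaining hs) (s.bundle i) else s.bundle i := by
      intro i
      split_ifs with h
      · subst h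
        exact takeTurn_bundle_self _ _ _ _
      · exact takeTurn_bundle_of_ne _ h _
    have hr : (takeTurn u a s).remaining = s.remaining.erase (favorite (u a) s.remaining hs) := by
      simp [takeTurn, hs]
    simp only [hb, hr]
    generalize favorite (u a) s.remaining hs = f at hf
    simp only [Finset.disjoint_left] at h1 h2 ⊢
    refine ⟨fun i j => ?_, fun i i' hii j => ?_, fun j => ?_⟩
    · have := @h1 i j
      grind
    · have := @h2 i i' hii j
      have := @h1 i f
      have := @h1 i' f
      grind
    · by_cases hj : j = f
      · exact Or.inr ⟨a, by simp [hj]⟩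
      · rcases h3 j with h | ⟨i, h⟩
        · exact Or.inl (Finset.mem_erase.2 ⟨hj, h⟩)
        · refine Or.inr ⟨i, ?_⟩
          split_ifs
          · exact Finset.mem_insert_of_mem h
          · exact h

theorem isAllocation_roundRobin (u : Fin n → Fin m → ℝ) : IsAllocation (roundRobin u) := by
  obtain ⟨-, h2, h3⟩ := rrState_invariant u m
  refine ⟨h2, fun j => (h3 j).resolve_left fun hj => ?_⟩
  have : remainingItems u m = ∅ := Finset.card_eq_zero.1 (by rw [card_remainingItems]; omega)
  rw [remainingItems] at this
  simp [this] at hj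

theorem remainingItems_nonempty (u : Fin n → Fin m → ℝ) {t : ℕ} (ht : t < m) :
    (remainingItems u t).Nonempty :=
  Finset.card_pos.1 (by rw [card_remainingItems]; omega)

theorem ofNat_mul_add (i : Fin n) (t : ℕ) : Fin.ofNat n (t * n + i) = i := by
  ext
  simp [Nat.mod_eq_of_lt i.isLt]

/-- An agent's bundle contains, for each of her turns `0, …, L - 1`, an item that she likes best
among those remaining at this turn, and these items are distinct. -/
theorem exists_picks (u : Fin n → Fin m → ℝ) (i : Fin n) {L : ℕ} (hL0 : 0 < L)
    (hL : ∀ t < L, t * n + i < m) :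
    ∃ p : ℕ → Fin m, Set.InjOn p (Finset.range L) ∧ ∀ t < L, p t ∈ roundRobin u i ∧
      ∀ k ∈ remainingItems u (t * n + i), u i k ≤ u i (p t) := by
  have hex : ∀ t, ∃ j, t < L → (j ∈ roundRobin u i ∧ j ∈ remainingItems u (t * n + i) ∧
      j ∉ remainingItems u (t * n + i + 1) ∧
      ∀ k ∈ remainingItems u (t * n + i), u i k ≤ u i j) := by
    intro t
    by_cases ht : t < L
    swap
    -- A junk value beyond the last turn considered; `hL0` ensures that `Fin m` is inhabited.
    · exact ⟨⟨0, (Nat.zero_le _).trans_lt (hL 0 hL0)⟩, fun h => absurd h ht⟩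
    have hne := remainingItems_nonempty u (hL t ht)
    obtain ⟨h1, h2⟩ := favorite_spec (u i) _ hne
    refine ⟨favorite (u i) _ hne, fun _ => ⟨?_, h1, ?_, h2⟩⟩
    · refine rrState_bundle_mono u i (show t * n + i + 1 ≤ m from hL t ht) ?_
      change _ ∈ (takeTurn u (Fin.ofNat n (t * n + i)) (rrState u (t * n + i))).bundle i
      rw [ofNat_mul_add, takeTurn_bundle_self u i _ hne]
      exact Finset.mem_insert_self _ _
    · rw [remainingItems_succ, ofNat_mul_add, removeFavorite, dif_pos hne]
      simp
  choose p hp using hex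
  refine ⟨p, ?_, fun t ht => ⟨(hp t ht).1, (hp t ht).2.2.2⟩⟩
  -- An item taken at turn s has left the remaining set, which only shrinks, so it cannot be
  -- available at turn t.
  have key : ∀ s t, s < t → t < L → p s ≠ p t := by
    intro s t hst ht heq
    refine (hp s (hst.trans ht)).2.2.1 ?_
    rw [heq]
    refine remainingItems_antitone u ?_ (hp t ht).2.1
    nlinarith [NeZero.pos n]
  intro s hs t ht heq
  simp only [Finset.coe_range, Set.mem_Iio] at hs ht
  rcases lt_trichotomy s t with h | h | h
  · exact absurd heq (key s t h ht)
  · exact h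
  · exact absurd heq.symm (key t s h hs)

/-- Whatever remains at turn t was already available at turn s ≤ t, so the pick of turn s is at
least as good. Nonnegativity allows the other items of the bundle to be dropped. -/
theorem exists_sum_picks_le (u : Fin n → Fin m → ℝ) (i : Fin n) (h0 : ∀ j, 0 ≤ u i j) {L : ℕ}
    (hL0 : 0 < L) (hL : (L - 1) * n + i < m) :
    ∃ x : ℕ → ℝ, ∑ t ∈ Finset.range L, x t ≤ ∑ j ∈ roundRobin u i, u i j ∧
      ∀ s t, s ≤ t → t < L → ∀ k ∈ remainingItems u (t * n + i), u i k ≤ x s := by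
  have hL' : ∀ t < L, t * n + i < m := fun t ht =>
    lt_of_le_of_lt (by gcongr; omega) hL
  obtain ⟨p, hinj, hp⟩ := exists_picks u i hL0 hL'
  refine ⟨fun t => u i (p t), ?_, fun s t hst ht k hk => ?_⟩
  · rw [← Finset.sum_image (f := u i) hinj]
    refine Finset.sum_le_sum_of_subset_of_nonneg ?_ fun j _ _ => h0 j
    intro j hj
    obtain ⟨t, ht, rfl⟩ := Finset.mem_image.1 hj
    exact (hp t (Finset.mem_range.1 ht)).1
  · refine (hp s (hst.trans_lt ht)).2 k (remainingItems_antitone u ?_ hk)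
    gcongr

theorem mul_le_sum_roundRobin (u : Fin n → Fin m → ℝ) (i : Fin n) (h0 : ∀ j, 0 ≤ u i j) {t : ℕ}
    (ht : t * n + i < m) {y : ℝ} (hy : ∃ k ∈ remainingItems u (t * n + i), y ≤ u i k) :
    (t + 1) * y ≤ ∑ j ∈ roundRobin u i, u i j := by
  obtain ⟨x, hx, hxk⟩ := exists_sum_picks_le u i h0 (Nat.succ_pos t) (by simpa using ht)
  obtain ⟨k, hk, hyk⟩ := hy
  refine le_trans ?_ hx
  have : ∀ s ∈ Finset.range (t + 1), y ≤ x s := fun s hs =>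
    hyk.trans (hxk s t (Nat.lt_succ_iff.1 (Finset.mem_range.1 hs)) (Nat.lt_succ_self t) k hk)
  simpa using Finset.card_nsmul_le_sum _ _ _ this

theorem mul_add_le_sum_roundRobin (u : Fin n → Fin m → ℝ) (i : Fin n) (h0 : ∀ j, 0 ≤ u i j)
    {t : ℕ} (ht : (t + 1) * n + i < m) {y z : ℝ}
    (hy : ∃ k ∈ remainingItems u (t * n + i), y ≤ u i k)
    (hz : ∃ k ∈ remainingItems u ((t + 1) * n + i), z ≤ u i k) :
    (t + 1) * y + z ≤ ∑ j ∈ roundRobin u i, u i j := by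
  obtain ⟨x, hx, hxk⟩ := exists_sum_picks_le u i h0 (Nat.succ_pos (t + 1)) (by simpa using ht)
  obtain ⟨k, hk, hyk⟩ := hy
  obtain ⟨l, hl, hzl⟩ := hz
  refine le_trans ?_ hx
  rw [Finset.sum_range_succ]
  refine add_le_add ?_ (hzl.trans (hxk _ _ le_rfl (Nat.lt_succ_self _) l hl))
  have : ∀ s ∈ Finset.range (t + 1), y ≤ x s := fun s hs =>
    hyk.trans (hxk s t (Nat.lt_succ_iff.1 (Finset.mem_range.1 hs)) (by omega) k hk)
  simpa using Finset.card_nsmul_le_sum _ _ _ this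

/-- When `m = 2 * n - 1`, the last agent has only one turn. -/
theorem card_roundRobin_last_le (u : Fin n → Fin (2 * n - 1) → ℝ) (i : Fin n)
    (hi : (i : ℕ) = n - 1) : (roundRobin u i).card ≤ 1 := by
  have hn := NeZero.pos n
  -- The second turn of the last agent would be number 2n - 1, one past the end.
  have hne : ∀ t, t < 2 * n - 1 → t ≠ n - 1 → i ≠ Fin.ofNat n t := by
    rintro t ht htn h
    have h' : (i : ℕ) = t % n := by rw [h]; rfl
    rcases lt_or_ge t n with h1 | h1
    · rw [Nat.mod_eq_of_lt h1] at h'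
      omega
    · rw [Nat.mod_eq_sub_mod h1, Nat.mod_eq_of_lt (by omega)] at h'
      omega
  have h1 : ∀ t ≤ n - 1, (rrState u t).bundle i = ∅ := by
    intro t
    induction t with
    | zero => exact fun _ => rfl
    | succ t ih =>
      intro ht
      exact (takeTurn_bundle_of_ne u (hne t (by omega) (by omega)) _).trans (ih (by omega))
  have h2 : ∀ t, n + t ≤ 2 * n - 1 → ((rrState u (n + t)).bundle i).card ≤ 1 := by
    intro t
    induction t with
    | zero =>
      intro _
      have h := card_takeTurn_bundle_le u (Fin.ofNat n (n - 1)) i (rrState u (n - 1))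
      rw [h1 _ le_rfl] at h
      have h3 : n + 0 = n - 1 + 1 := by omega
      rw [h3]
      exact h
    | succ t ih =>
      intro ht
      have h := takeTurn_bundle_of_ne u (hne (n + t) (by omega) (by omega)) (rrState u (n + t))
      exact (congrArg Finset.card h).trans_le (ih (by omega))
  have := h2 (n - 1) (by omega)
  have h3 : n + (n - 1) = 2 * n - 1 := by omega
  rwa [h3] at this

/-! ### The process as seen by one agent -/

/-- The items that remain in `S` after the turns `a, a + 1, …, a + l - 1`. -/
noncomputable def runTurns (u : Fin n → Fin m → ℝ) (a : ℕ) (S : Finset (Fin m)) :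
    ℕ → Finset (Fin m)
  | 0 => S
  | l + 1 => removeFavorite (u (Fin.ofNat n (a + l))) (runTurns u a S l)

theorem remainingItems_add (u : Fin n → Fin m → ℝ) (a l : ℕ) :
    remainingItems u (a + l) = runTurns u a (remainingItems u a) l := by
  induction l with
  | zero => rfl
  | succ l ih => rw [← add_assoc, remainingItems_succ, ih, runTurns]

theorem runTurns_subset (u : Fin n → Fin m → ℝ) (a : ℕ) (S : Finset (Fin m)) (l : ℕ) :
    runTurns u a S l ⊆ S := by
  induction l with
  | zero => exact subset_rfl
  | succ l ih => exact (removeFavorite_subset _ _).trans ih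

theorem card_runTurns (u : Fin n → Fin m → ℝ) (a : ℕ) (S : Finset (Fin m)) (l : ℕ) :
    (runTurns u a S l).card = S.card - l := by
  induction l with
  | zero => rfl
  | succ l ih =>
    rw [runTurns, card_removeFavorite, ih]
    omega

/-- Two offsets are allowed because only the turn modulo n matters: every block of n - 1 turns
between two turns of one agent is then the same map. -/
theorem runTurns_congr {u w : Fin n → Fin m → ℝ} {a b : ℕ} (S : Finset (Fin m)) {l : ℕ}
    (h : ∀ k < l, u (Fin.ofNat n (a + k)) = w (Fin.ofNat n (b + k))) :
    runTurns u a S l = runTurns w b S l := by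
  induction l with
  | zero => rfl
  | succ l ih =>
    rw [runTurns, runTurns, ih fun k hk => h k (hk.trans (Nat.lt_succ_self l)),
      h l (Nat.lt_succ_self l)]

theorem ofNat_add_ne (i : Fin n) {k : ℕ} (hk : k < n - 1) (a : ℕ) :
    Fin.ofNat n (a * n + i + 1 + k) ≠ i := by
  intro h
  have h' : (a * n + i + 1 + k) % n = i := congrArg Fin.val h
  have h1 : a * n + i + 1 + k = (i + 1 + k) + n * a := by ring
  rw [h1, Nat.add_mul_mod_self_left] at h'
  have hi := i.isLt
  rcases lt_or_ge (i + 1 + k) n with h2 | h2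
  · rw [Nat.mod_eq_of_lt h2] at h'
    omega
  · rw [Nat.mod_eq_sub_mod h2, Nat.mod_eq_of_lt (by omega)] at h'
    omega

/-- The items that remain before agent `i`'s turns, when the utilities of the other agents are
fixed: between two turns of agent `i`, a fixed set-valued map is applied. -/
theorem remainingItems_update (u : Fin n → Fin m → ℝ) (i : Fin n) (v : Fin m → ℝ) (t : ℕ) :
    remainingItems (Function.update u i v) (t * n + i) =
      (fun S => runTurns u (i + 1) (removeFavorite v S) (n - 1))^[t] (remainingItems u i) := by
  induction t with
  | zero =>
    have h1 := remainingItems_add (Function.update u i v) 0 i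
    have h2 := remainingItems_add u 0 i
    rw [zero_add, remainingItems_zero] at h1 h2
    rw [zero_mul, zero_add, Function.iterate_zero_apply, h1, h2]
    -- Agent i has not moved in the first i turns, so her utilities are irrelevant to them.
    refine runTurns_congr _ fun k hk => Function.update_of_ne ?_ _ _
    intro h
    have h' : (0 + k) % n = i := congrArg Fin.val h
    rw [zero_add, Nat.mod_eq_of_lt (hk.trans i.isLt)] at h'
    omega
  | succ t ih =>
    have hn := NeZero.pos n
    have h1 : (t + 1) * n + i = t * n + i + 1 + (n - 1) := by
      have : (t + 1) * n = t * n + n := by ring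
      omega
    rw [Function.iterate_succ_apply', ← ih, h1, remainingItems_add, remainingItems_succ,
      ofNat_mul_add, Function.update_self]
    refine runTurns_congr _ fun k hk => ?_
    rw [Function.update_of_ne (ofNat_add_ne i hk t)]
    congr 1
    ext
    have : t * n + i + 1 + k = i + 1 + k + n * t := by ring
    simp only [Fin.val_ofNat]
    rw [this, Nat.add_mul_mod_self_left]

end Deterministic

theorem measurableSet_forall_mem_le {ι : Type*} (T : Finset ι) (f g : ι → (ι → ℝ) → ℝ)
    (hf : ∀ k, Measurable (f k)) (hg : ∀ k, Measurable (g k)) :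
    MeasurableSet {v : ι → ℝ | ∀ k ∈ T, f k v ≤ g k v} := by
  have : {v : ι → ℝ | ∀ k ∈ T, f k v ≤ g k v} = ⋂ k ∈ T, {v | f k v ≤ g k v} := by
    ext
    simp
  rw [this]
  exact Finset.measurableSet_biInter _ fun k _ => measurableSet_le (hf k) (hg k)

/-! ### Resampling coordinates of a product measure -/

section Product

variable {ι : Type*} [Fintype ι] [DecidableEq ι]

/-- Replacing one coordinate by an independent copy does not change the law. This is Fubini with one
coordinate singled out, without splitting the index type; it is used both for an agent and for a
single item. -/
theorem measurePreserving_update {X : ι → Type*} [∀ i, MeasurableSpace (X i)]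
    (μ : ∀ i, Measure (X i)) [∀ i, IsProbabilityMeasure (μ i)] (i : ι) :
    MeasurePreserving (fun p : (∀ i, X i) × X i => Function.update p.1 i p.2)
      ((Measure.pi μ).prod (μ i)) (Measure.pi μ) := by
  refine ⟨measurable_update', (Measure.pi_eq fun s hs => ?_).symm⟩
  rw [Measure.map_apply measurable_update' (MeasurableSet.univ_pi hs)]
  have h : (fun p : (∀ i, X i) × X i => Function.update p.1 i p.2) ⁻¹' Set.pi Set.univ s =
      (Set.pi Set.univ (Function.update s i Set.univ)) ×ˢ s i := by
    ext p
    simp only [Set.mem_preimage, Set.mem_pi, Set.mem_univ, true_imp_iff, Set.mem_prod]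
    constructor
    · intro hp
      refine ⟨fun k => ?_, by simpa using hp i⟩
      by_cases hk : k = i
      · subst hk
        simp
      · simpa [hk] using hp k
    · rintro ⟨hp, hi⟩ k
      by_cases hk : k = i
      · subst hk
        simpa using hi
      · simpa [hk] using hp k
  rw [h, Measure.prod_prod, Measure.pi_pi, ← Finset.prod_erase_mul _ _ (Finset.mem_univ i),
    ← Finset.prod_erase_mul (a := i) _ _ (Finset.mem_univ i)]
  congr 1
  rw [Function.update_self, measure_univ, mul_one]
  refine Finset.prod_congr rfl fun k hk => ?_
  rw [Function.update_of_ne (Finset.ne_of_mem_erase hk)]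

theorem pi_apply_eq_lintegral_update {X : ι → Type*} [∀ i, MeasurableSpace (X i)]
    (μ : ∀ i, Measure (X i)) [∀ i, IsProbabilityMeasure (μ i)] (i : ι) {A : Set (∀ i, X i)}
    (hA : MeasurableSet A) :
    Measure.pi μ A = ∫⁻ z, Measure.pi μ {x | Function.update x i z ∈ A} ∂μ i := by
  rw [← (measurePreserving_update μ i).measure_preimage hA.nullMeasurableSet,
    Measure.prod_apply_symm (measurable_update' hA)]
  rfl

theorem pi_le_of_forall_update {X : ι → Type*} [∀ i, MeasurableSpace (X i)]
    (μ : ∀ i, Measure (X i)) [∀ i, IsProbabilityMeasure (μ i)] (i : ι) {A : Set (∀ i, X i)}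
    (hA : MeasurableSet A) {C : ENNReal} (h : ∀ x, μ i {z | Function.update x i z ∈ A} ≤ C) :
    Measure.pi μ A ≤ C := by
  rw [← (measurePreserving_update μ i).measure_preimage hA.nullMeasurableSet,
    Measure.prod_apply (measurable_update' hA)]
  refine (lintegral_mono h).trans ?_
  simp

variable {D : Measure ℝ} [IsProbabilityMeasure D]

/-- Independence: `hT` says that P does not depend on the coordinates in T, which are integrated out
one by one. -/
theorem pi_forall_mem_and {C : Set ℝ} (hC : MeasurableSet C) (T : Finset ι) {P : Set (ι → ℝ)}
    (hP : MeasurableSet P) (hT : ∀ k ∈ T, ∀ v z, Function.update v k z ∈ P ↔ v ∈ P) :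
    Measure.pi (fun _ : ι => D) {v | (∀ k ∈ T, v k ∈ C) ∧ v ∈ P} =
      D C ^ T.card * Measure.pi (fun _ : ι => D) P := by
  induction T using Finset.induction_on with
  | empty => simp
  | insert a T ha ih =>
    have hm : MeasurableSet {v : ι → ℝ | (∀ k ∈ T, v k ∈ C) ∧ v ∈ P} := by
      refine MeasurableSet.inter ?_ hP
      have : {v : ι → ℝ | ∀ k ∈ T, v k ∈ C} = ⋂ k ∈ T, (fun v => v k) ⁻¹' C := by
        ext
        simp
      change MeasurableSet {v : ι → ℝ | ∀ k ∈ T, v k ∈ C}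
      rw [this]
      exact Finset.measurableSet_biInter _ fun k _ => measurable_pi_apply k hC
    have hs : {v : ι → ℝ | (∀ k ∈ insert a T, v k ∈ C) ∧ v ∈ P} =
        (fun v => v a) ⁻¹' C ∩ {v | (∀ k ∈ T, v k ∈ C) ∧ v ∈ P} := by
      ext
      simp [and_assoc]
    rw [hs, pi_apply_eq_lintegral_update _ a ((measurable_pi_apply a hC).inter hm)]
    have hi : ∀ z, Measure.pi (fun _ : ι => D) {x | Function.update x a z ∈
        (fun v : ι → ℝ => v a) ⁻¹' C ∩ {v | (∀ k ∈ T, v k ∈ C) ∧ v ∈ P}} =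
        C.indicator (fun _ => Measure.pi (fun _ : ι => D) {v | (∀ k ∈ T, v k ∈ C) ∧ v ∈ P}) z := by
      intro z
      by_cases hz : z ∈ C
      · rw [Set.indicator_of_mem hz]
        congr 1
        ext v
        simp only [Set.mem_inter_iff, Set.mem_preimage, Function.update_self, Set.mem_ofPred_eq, hz,
          true_and, hT a (Finset.mem_insert_self a T)]
        refine and_congr_left fun _ => forall₂_congr fun k hk => ?_
        rw [Function.update_of_ne (ne_of_mem_of_not_mem hk ha)]
      · rw [Set.indicator_of_notMem hz]
        simp [hz]
    simp_rw [hi]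
    rw [lintegral_indicator hC, setLIntegral_const,
      ih fun k hk => hT k (Finset.mem_insert_of_mem hk), Finset.card_insert_of_notMem ha]
    ring

theorem pi_forall_mem {C : Set ℝ} (hC : MeasurableSet C) (T : Finset ι) :
    Measure.pi (fun _ : ι => D) {v | ∀ k ∈ T, v k ∈ C} = D C ^ T.card := by
  have h := pi_forall_mem_and (D := D) hC T MeasurableSet.univ (by simp)
  simpa using h

/-- The integral is the probability that, among k + 1 independent samples, a given one is the
largest and is at most x. These k + 1 events are equally likely, almost disjoint since D has no
atoms, and each forces all samples to be at most x. -/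
theorem lintegral_Iic_pow_le [NullSingletonClass D] (k : ℕ) (x : ℝ) :
    ∫⁻ z in Set.Iic x, D (Set.Iic z) ^ k ∂D ≤ D (Set.Iic x) ^ (k + 1) / (k + 1 : ℕ) := by
  let A : Fin (k + 1) → Set (Fin (k + 1) → ℝ) :=
    fun j => {v | v j ≤ x ∧ ∀ l ∈ Finset.univ.erase j, v l ≤ v j}
  have hA : ∀ j, MeasurableSet (A j) := fun j =>
    (measurableSet_le (measurable_pi_apply j) measurable_const).inter
      (measurableSet_forall_mem_le _ _ _ (fun l => measurable_pi_apply l)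
        fun _ => measurable_pi_apply j)
  have hAm : ∀ j, Measure.pi (fun _ : Fin (k + 1) => D) (A j) =
      ∫⁻ z in Set.Iic x, D (Set.Iic z) ^ k ∂D := by
    intro j
    rw [pi_apply_eq_lintegral_update _ j (hA j), ← lintegral_indicator measurableSet_Iic]
    refine lintegral_congr fun z => ?_
    by_cases hz : z ∈ Set.Iic x
    · rw [Set.indicator_of_mem hz]
      have h := pi_forall_mem (D := D) (measurableSet_Iic (a := z)) (Finset.univ.erase j)
      rw [Finset.card_erase_of_mem (Finset.mem_univ j), Finset.card_univ, Fintype.card_fin,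
        Nat.add_sub_cancel] at h
      rw [← h]
      congr 1
      ext v
      simp only [A, Set.mem_ofPred_eq, Function.update_self]
      refine (and_iff_right hz).trans (forall₂_congr fun l hl => ?_)
      rw [Function.update_of_ne (Finset.ne_of_mem_erase hl)]
      rfl
    · rw [Set.indicator_of_notMem hz]
      have : {v : Fin (k + 1) → ℝ | Function.update v j z ∈ A j} = ∅ := by
        ext v
        simp only [A, Set.mem_ofPred_eq, Function.update_self, Set.mem_empty_iff_false, iff_false]
        exact fun h => hz h.1
      rw [this, measure_empty]
  have hd : Pairwise (Function.onFun (AEDisjoint (Measure.pi fun _ : Fin (k + 1) => D)) A) := by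
    intro j l hjl
    have hm : MeasurableSet {v : Fin (k + 1) → ℝ | v j = v l} :=
      measurableSet_eq_fun (measurable_pi_apply j) (measurable_pi_apply l)
    refine measure_mono_null (t := {v : Fin (k + 1) → ℝ | v j = v l}) ?_ ?_
    · rintro v ⟨h1, h2⟩
      exact le_antisymm (h2.2 j (by simpa using hjl)) (h1.2 l (by simpa using hjl.symm))
    · refine le_antisymm (pi_le_of_forall_update _ j hm fun v => ?_) (zero_le)
      refine (measure_mono (t := {v l}) ?_).trans (measure_singleton _).le
      intro z hz
      simpa [Function.update_of_ne hjl.symm] using hz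
  have hsum := tsum_meas_le_meas_iUnion_of_disjoint₀ (Measure.pi fun _ : Fin (k + 1) => D)
    (fun j => (hA j).nullMeasurableSet) hd
  have hle : Measure.pi (fun _ : Fin (k + 1) => D) (⋃ j, A j) ≤ D (Set.Iic x) ^ (k + 1) := by
    have h := pi_forall_mem (D := D) (measurableSet_Iic (a := x)) (Finset.univ : Finset (Fin (k+1)))
    rw [Finset.card_univ, Fintype.card_fin] at h
    rw [← h]
    refine measure_mono (Set.iUnion_subset fun j v hv l _ => ?_)
    by_cases hl : l = j
    · exact hl ▸ hv.1
    · exact (hv.2 l (by simpa using hl)).trans hv.1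
  rw [ENNReal.le_div_iff_mul_le (by simp) (by simp), mul_comm]
  refine le_trans ?_ (hsum.trans hle)
  rw [tsum_fintype]
  simp_rw [hAm]
  simp

end Product

/-- The items and item sets produced by the algorithm take finitely many values, so measurability
can be checked with the value fixed. -/
theorem measurableSet_of_fibers {Ω β : Type*} [MeasurableSpace Ω] [Countable β] {g : Ω → β}
    {p : Ω → β → Prop} (hg : ∀ b, MeasurableSet {ω | g ω = b})
    (hp : ∀ b, MeasurableSet {ω | p ω b}) : MeasurableSet {ω | p ω (g ω)} := by
  have : {ω | p ω (g ω)} = ⋃ b, {ω | g ω = b} ∩ {ω | p ω b} := by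
    ext
    simp
  rw [this]
  exact MeasurableSet.iUnion fun b => (hg b).inter (hp b)

/-! ### One agent with i.i.d. utilities against a fixed removal rule -/

section AlternatingRemoval

variable {m : ℕ}

theorem measurableSet_favorite_eq (S : Finset (Fin m)) (hS : S.Nonempty) (j : Fin m) :
    MeasurableSet {v : Fin m → ℝ | favorite v S hS = j} := by
  have hm : ∀ l : Fin m, MeasurableSet {v : Fin m → ℝ | ∀ k ∈ S, v k ≤ v l} := fun l =>
    measurableSet_forall_mem_le _ _ _ measurable_pi_apply fun _ => measurable_pi_apply l
  have : {v : Fin m → ℝ | favorite v S hS = j} = {v | j ∈ S ∧ (∀ k ∈ S, v k ≤ v j) ∧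
      ∀ l : Fin m, l ∈ S → l < j → ¬ ∀ k ∈ S, v k ≤ v l} := by
    ext v
    simp only [Set.mem_ofPred_eq]
    constructor
    · rintro rfl
      obtain ⟨h1, h2⟩ := favorite_spec v S hS
      refine ⟨h1, h2, fun l hl hlt h => ?_⟩
      exact absurd (Finset.min'_le _ l (Finset.mem_filter.2 ⟨hl, h⟩)) (not_le.2 hlt)
    · rintro ⟨h1, h2, h3⟩
      obtain ⟨h4, h5⟩ := favorite_spec v S hS
      refine le_antisymm (Finset.min'_le _ j (Finset.mem_filter.2 ⟨h1, h2⟩)) ?_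
      by_contra hlt
      exact h3 _ h4 (not_le.1 hlt) h5
  have h : {v : Fin m → ℝ | ∀ l : Fin m, l ∈ S → l < j → ¬ ∀ k ∈ S, v k ≤ v l} =
      ⋂ l : Fin m, ⋂ _ : l ∈ S, ⋂ _ : l < j, {v | ∀ k ∈ S, v k ≤ v l}ᶜ := by
    ext v
    simp only [Set.mem_iInter, Set.mem_compl_iff, Set.mem_ofPred_eq]
  have h' : MeasurableSet {v : Fin m → ℝ | ∀ l : Fin m, l ∈ S → l < j → ¬ ∀ k ∈ S, v k ≤ v l} := by
    rw [h]
    exact MeasurableSet.iInter fun l => MeasurableSet.iInter fun _ => MeasurableSet.iInter fun _ =>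
      (hm l).compl
  rw [this]
  exact MeasurableSet.inter (MeasurableSet.const _) (MeasurableSet.inter (hm j) h')

theorem measurableSet_removeFavorite_eq (S R : Finset (Fin m)) :
    MeasurableSet {v : Fin m → ℝ | removeFavorite v S = R} := by
  unfold removeFavorite
  split_ifs with h
  · exact measurableSet_of_fibers (p := fun _ j => S.erase j = R) (measurableSet_favorite_eq S h)
      fun _ => MeasurableSet.const _
  · exact MeasurableSet.const _

theorem measurableSet_iterate_eq (N : Finset (Fin m) → Finset (Fin m)) (t : ℕ)
    (S R : Finset (Fin m)) :
    MeasurableSet {v : Fin m → ℝ | (fun S => N (removeFavorite v S))^[t] S = R} := by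
  induction t generalizing R with
  | zero => exact MeasurableSet.const (S = R)
  | succ t ih =>
    simp_rw [Function.iterate_succ_apply']
    exact measurableSet_of_fibers (p := fun v Q => N (removeFavorite v Q) = R) ih fun Q =>
      measurableSet_of_fibers (p := fun _ Q => N Q = R) (measurableSet_removeFavorite_eq Q)
        fun _ => MeasurableSet.const _

theorem iterate_subset {N : Finset (Fin m) → Finset (Fin m)} (hN : ∀ S, N S ⊆ S)
    (v : Fin m → ℝ) (t : ℕ) (S : Finset (Fin m)) :
    (fun S => N (removeFavorite v S))^[t] S ⊆ S := by
  induction t with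
  | zero => exact subset_rfl
  | succ t ih =>
    rw [Function.iterate_succ_apply']
    exact (hN _).trans ((removeFavorite_subset _ _).trans ih)

/-- Utilities of items outside S have no influence on later rounds; this is the source of
independence in `pi_iterate_lt_le`. -/
theorem iterate_congr {N : Finset (Fin m) → Finset (Fin m)} (hN : ∀ S, N S ⊆ S)
    {v w : Fin m → ℝ} (t : ℕ) {S : Finset (Fin m)} (h : ∀ k ∈ S, v k = w k) :
    (fun S => N (removeFavorite v S))^[t] S = (fun S => N (removeFavorite w S))^[t] S := by
  induction t with
  | zero => rfl
  | succ t ih =>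
    rw [Function.iterate_succ_apply', Function.iterate_succ_apply', ← ih]
    congr 1
    exact removeFavorite_congr fun k hk => h k (iterate_subset hN v t S hk)

theorem measurableSet_iterate_lt (N : Finset (Fin m) → Finset (Fin m)) (t : ℕ)
    (S : Finset (Fin m)) (y : ℝ) :
    MeasurableSet {v : Fin m → ℝ | ∀ j ∈ (fun S => N (removeFavorite v S))^[t] S, v j < y} := by
  refine measurableSet_of_fibers (p := fun v Q => ∀ j ∈ Q, v j < y)
    (measurableSet_iterate_eq N t S) fun Q => ?_
  simp only [Set.ofPred_forall]
  exact MeasurableSet.iInter fun l => MeasurableSet.iInter fun _ =>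
    measurableSet_lt (measurable_pi_apply l) measurable_const

/-- An agent with i.i.d. utilities repeatedly takes her favorite among the remaining items, and
after each of these turns `n - 1` further items are removed, depending only on the remaining set.
This bounds the probability that all items in the initial set are at most `x` and that, after `t`
rounds, all the `r` remaining items are less than `y`. -/
theorem pi_iterate_lt_le {D : Measure ℝ} [IsProbabilityMeasure D] [NullSingletonClass D] {n : ℕ} (hn : 0 < n)
    {N : Finset (Fin m) → Finset (Fin m)} (hN : ∀ S, N S ⊆ S)
    (hcard : ∀ S, (N S).card = S.card - (n - 1)) (y : ℝ) (r t : ℕ) (S : Finset (Fin m))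
    (hS : S.card = r + t * n) (x : ℝ) :
    Measure.pi (fun _ : Fin m => D) {v | (∀ j ∈ S, v j ≤ x) ∧
      ∀ j ∈ (fun S => N (removeFavorite v S))^[t] S, v j < y} ≤
    (∏ s ∈ Finset.range t, ((r + (s + 1) * n : ℕ) / ((s + 1) * n : ℕ) : ENNReal)) *
      D (Set.Iic y) ^ r * D (Set.Iic x) ^ (t * n) := by
  -- The cap x must vary: once the favorite is worth z, every other item is capped by z.
  induction t generalizing S x with
  | zero =>
    simp only [Finset.range_zero, Finset.prod_empty, zero_mul, pow_zero, mul_one, one_mul,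
      Function.iterate_zero_apply]
    have h := pi_forall_mem (D := D) (measurableSet_Iic (a := y)) S
    rw [hS, zero_mul, add_zero] at h
    rw [← h]
    exact measure_mono fun v hv k hk => (hv.2 k hk).le
  | succ t ih =>
    set c : ENNReal :=
      ∏ s ∈ Finset.range t, ((r + (s + 1) * n : ℕ) / ((s + 1) * n : ℕ) : ENNReal) with hc
    have htn : (t + 1) * n = t * n + n := by ring
    have hSne : S.Nonempty := Finset.card_pos.1 (by omega)
    -- `E j` is the case in which item j can serve as the first pick. The union bound over j ∈ S
    -- contributes the numerator r + (t + 1)n.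
    let E : Fin m → Set (Fin m → ℝ) := fun j => {v | (v j ≤ x ∧ ∀ k ∈ S.erase j, v k ≤ v j) ∧
      ∀ k ∈ (fun S => N (removeFavorite v S))^[t] (N (S.erase j)), v k < y}
    have hE : ∀ j, MeasurableSet (E j) := fun j =>
      ((measurableSet_le (measurable_pi_apply j) measurable_const).inter
        (measurableSet_forall_mem_le _ _ _ (fun l => measurable_pi_apply l)
          fun _ => measurable_pi_apply j)).inter (measurableSet_iterate_lt N t _ y)
    have hsub : {v : Fin m → ℝ | (∀ j ∈ S, v j ≤ x) ∧
        ∀ j ∈ (fun S => N (removeFavorite v S))^[t + 1] S, v j < y} ⊆ ⋃ j ∈ S, E j := by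
      rintro v ⟨hv1, hv2⟩
      obtain ⟨h1, h2⟩ := favorite_spec v S hSne
      refine Set.mem_iUnion₂.2 ⟨favorite v S hSne, h1,
        ⟨⟨hv1 _ h1, fun k hk => h2 k (Finset.mem_of_mem_erase hk)⟩, ?_⟩⟩
      rw [Function.iterate_succ_apply] at hv2
      simpa only [removeFavorite, dif_pos hSne] using hv2
    have hEj : ∀ j ∈ S, Measure.pi (fun _ : Fin m => D) (E j) ≤
        c * D (Set.Iic y) ^ r * (D (Set.Iic x) ^ ((t + 1) * n) / ((t + 1) * n : ℕ)) := by
      intro j hj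
      set S' := N (S.erase j) with hS'
      have hS'c : S'.card = r + t * n := by
        rw [hS', hcard, Finset.card_erase_of_mem hj]
        omega
      -- The n - 1 items deleted after the pick never matter again; each only has to lie below z,
      -- which gives the factor F(z)^(n - 1).
      have hT : (S.erase j \ S').card = n - 1 := by
        rw [Finset.card_sdiff_of_subset (hN _), hS'c, Finset.card_erase_of_mem hj]
        omega
      have hz : ∀ z, Measure.pi (fun _ : Fin m => D) {v | Function.update v j z ∈ E j} ≤
          (Set.Iic x).indicator
            (fun z => c * D (Set.Iic y) ^ r * D (Set.Iic z) ^ ((t + 1) * n - 1)) z := by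
        intro z
        by_cases hzx : z ∈ Set.Iic x
        swap
        · rw [Set.indicator_of_notMem hzx]
          have : {v : Fin m → ℝ | Function.update v j z ∈ E j} = ∅ := by
            ext v
            simp only [E, Set.mem_ofPred_eq, Function.update_self, Set.mem_empty_iff_false,
              iff_false]
            exact fun h => hzx h.1.1
          rw [this, measure_empty]
        rw [Set.indicator_of_mem hzx]
        have hup : ∀ k ∉ S', ∀ (v : Fin m → ℝ) (w : ℝ),
            (fun S => N (removeFavorite (Function.update v k w) S))^[t] S' =
              (fun S => N (removeFavorite v S))^[t] S' := fun k hk v w =>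
          iterate_congr hN t fun l hl => Function.update_of_ne (ne_of_mem_of_not_mem hl hk) _ _
        have hjS' : j ∉ S' := fun h => Finset.notMem_erase j S (hN _ h)
        let P : Set (Fin m → ℝ) := {v | (∀ k ∈ S', v k ≤ z) ∧
          ∀ k ∈ (fun S => N (removeFavorite v S))^[t] S', v k < y}
        have hP : MeasurableSet P := (measurableSet_forall_mem_le _ _ _
          (fun l => measurable_pi_apply l) fun _ => measurable_const).inter
            (measurableSet_iterate_lt N t _ y)
        have hPu : ∀ k ∈ S.erase j \ S', ∀ v w, Function.update v k w ∈ P ↔ v ∈ P := by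
          intro k hk v w
          have hk' := (Finset.mem_sdiff.1 hk).2
          simp only [P, Set.mem_ofPred_eq, hup k hk']
          refine and_congr (forall₂_congr fun l hl => ?_) (forall₂_congr fun l hl => ?_)
          · rw [Function.update_of_ne (ne_of_mem_of_not_mem hl hk')]
          · rw [Function.update_of_ne (ne_of_mem_of_not_mem (iterate_subset hN v t S' hl) hk')]
        have hbox := pi_forall_mem_and (D := D) (measurableSet_Iic (a := z)) _ hP hPu
        rw [hT] at hbox
        calc Measure.pi (fun _ : Fin m => D) {v | Function.update v j z ∈ E j}
            ≤ Measure.pi (fun _ : Fin m => D)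
              {v | (∀ k ∈ S.erase j \ S', v k ∈ Set.Iic z) ∧ v ∈ P} := by
              refine measure_mono fun v hv => ?_
              simp only [E, Set.mem_ofPred_eq, Function.update_self, ← hS', hup j hjS'] at hv
              obtain ⟨⟨-, h1⟩, h2⟩ := hv
              have h1' : ∀ k ∈ S.erase j, v k ≤ z := fun k hk => by
                have := h1 k hk
                rwa [Function.update_of_ne (Finset.ne_of_mem_erase hk)] at this
              refine ⟨fun k hk => h1' k (Finset.mem_sdiff.1 hk).1,
                fun k hk => h1' k (hN _ hk), fun k hk => ?_⟩
              have := h2 k hk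
              rwa [Function.update_of_ne
                (ne_of_mem_of_not_mem (iterate_subset hN v t S' hk) hjS')] at this
          _ ≤ D (Set.Iic z) ^ (n - 1) * (c * D (Set.Iic y) ^ r * D (Set.Iic z) ^ (t * n)) := by
              rw [hbox]
              gcongr
              exact ih S' hS'c z
          _ = c * D (Set.Iic y) ^ r * D (Set.Iic z) ^ ((t + 1) * n - 1) := by
              have : (t + 1) * n - 1 = (n - 1) + t * n := by omega
              rw [this, pow_add]
              ring
      rw [pi_apply_eq_lintegral_update _ j (hE j)]
      refine (lintegral_mono hz).trans ?_
      rw [lintegral_indicator measurableSet_Iic, lintegral_const_mul]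
      · gcongr
        -- Integrating F(z)^((t + 1)n - 1) up to x yields the denominator (t + 1)n.
        have h := lintegral_Iic_pow_le (D := D) ((t + 1) * n - 1) x
        rwa [Nat.sub_add_cancel (by omega)] at h
      · have hF : Monotone fun z => D (Set.Iic z) := fun a b h =>
          measure_mono (Set.Iic_subset_Iic.2 h)
        exact hF.measurable.pow_const _
    refine (measure_mono hsub).trans ((measure_biUnion_finset_le _ _).trans
      ((Finset.sum_le_sum hEj).trans (le_of_eq ?_)))
    rw [Finset.sum_const, hS, Finset.prod_range_succ, ← hc, nsmul_eq_mul]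
    simp only [div_eq_mul_inv]
    ring

end AlternatingRemoval

/-! ### Tail bound for the items left before a given turn -/

section Picks

/-- Over the common denominator t!, each factor of the numerator is at most t + ρ, and (t + ρ)^t /
t! is a term of the exponential series of t + ρ. -/
theorem prod_one_add_div_le_exp (t : ℕ) {ρ : ℝ} (hρ : 0 ≤ ρ) :
    ∏ s ∈ Finset.range t, (1 + ρ / (s + 1)) ≤ Real.exp (t + ρ) := by
  have h1 : ∏ s ∈ Finset.range t, (1 + ρ / ((s : ℝ) + 1)) =
      (∏ s ∈ Finset.range t, ((s : ℝ) + 1 + ρ)) / (t.factorial : ℝ) := by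
    rw [← Finset.prod_range_add_one_eq_factorial, Nat.cast_prod, ← Finset.prod_div_distrib]
    refine Finset.prod_congr rfl fun s _ => ?_
    have : (s : ℝ) + 1 ≠ 0 := by positivity
    push_cast
    field_simp
  have h2 : ∏ s ∈ Finset.range t, ((s : ℝ) + 1 + ρ) ≤ (t + ρ) ^ t := by
    refine (Finset.prod_le_prod (fun s _ => by positivity) (g := fun _ => (t : ℝ) + ρ)
      fun s hs => ?_).trans_eq (by simp)
    have : (s : ℝ) + 1 ≤ t := by exact_mod_cast Finset.mem_range.1 hs
    linarith
  rw [h1]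
  refine le_trans ?_ (Real.pow_div_factorial_le_exp (t + ρ) (by positivity) t)
  gcongr

variable {D : Measure ℝ} [IsProbabilityMeasure D] {n m : ℕ}

theorem ae_pi_mem {ι : Type*} [Fintype ι] {C : Set ℝ} (hD : D Cᶜ = 0) :
    ∀ᵐ v ∂Measure.pi (fun _ : ι => D), ∀ k, v k ∈ C := by
  classical
  rw [ae_all_iff]
  intro k
  exact (measurePreserving_eval (fun _ : ι => D) k).quasiMeasurePreserving.ae
    (p := fun x => x ∈ C) hD

instance isProbabilityMeasure_utilityLaw : IsProbabilityMeasure (utilityLaw D n m) := by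
  unfold utilityLaw
  infer_instance

theorem ae_utilityLaw_mem {C : Set ℝ} (hD : D Cᶜ = 0) :
    ∀ᵐ u ∂utilityLaw D n m, ∀ i j, u i j ∈ C := by
  rw [ae_all_iff]
  intro i
  exact (measurePreserving_eval (fun _ : Fin n => Measure.pi fun _ : Fin m => D)
    i).quasiMeasurePreserving.ae (p := fun v => ∀ j, v j ∈ C) (ae_pi_mem hD)

variable [NeZero n]

theorem measurableSet_remainingItems_eq (t : ℕ) (R : Finset (Fin m)) :
    MeasurableSet {u : Fin n → Fin m → ℝ | remainingItems u t = R} := by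
  induction t generalizing R with
  | zero => exact MeasurableSet.const (Finset.univ = R)
  | succ t ih =>
    have hR : ∀ (k : Fin n) (Q : Finset (Fin m)),
        MeasurableSet {u : Fin n → Fin m → ℝ | removeFavorite (u k) Q = R} := by
      intro k Q
      have he : Measurable fun u : Fin n → Fin m → ℝ => u k := measurable_pi_apply k
      exact he (measurableSet_removeFavorite_eq Q R)
    simp only [remainingItems_succ]
    exact measurableSet_of_fibers (g := fun u => remainingItems u t)
      (p := fun u Q => removeFavorite (u (Fin.ofNat n t)) Q = R) ih
      (hR (Fin.ofNat n t))

theorem measurableSet_remainingItems_lt (i : Fin n) (t : ℕ) (y : ℝ) :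
    MeasurableSet {u : Fin n → Fin m → ℝ | ∀ k ∈ remainingItems u t, u i k < y} := by
  refine measurableSet_of_fibers (g := fun u => remainingItems u t) (p := fun u Q => ∀ j ∈ Q, u i j < y)
    (measurableSet_remainingItems_eq t) fun Q => ?_
  simp only [Set.ofPred_forall]
  exact MeasurableSet.iInter fun l => MeasurableSet.iInter fun _ =>
    measurableSet_lt ((measurable_pi_apply l).comp (measurable_pi_apply i)) measurable_const

/-- The probability that agent `i` values all items that remain before her turn number `t`
(counted from `0`) less than `y`. -/
theorem utilityLaw_remainingItems_lt_le [NullSingletonClass D] (hD : D (Set.Iic 1)ᶜ = 0)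
    (i : Fin n) (t r : ℕ) (hr : t * n + i + r = m) (y : ℝ) :
    (utilityLaw D n m).real {u | ∀ k ∈ remainingItems u (t * n + i), u i k < y} ≤
      Real.exp (t + r / n) * D.real (Set.Iic y) ^ r := by
  have hn := NeZero.pos n
  have hn' : (0 : ℝ) < n := by exact_mod_cast hn
  have key : utilityLaw D n m {u | ∀ k ∈ remainingItems u (t * n + i), u i k < y} ≤
      (∏ s ∈ Finset.range t, ((r + (s + 1) * n : ℕ) / ((s + 1) * n : ℕ) : ENNReal)) *
        D (Set.Iic y) ^ r := by
    -- Condition on the utilities of all agents other than i. The process then starts from the items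
    -- left after i turns, with the cap x = 1, which holds almost surely.
    refine pi_le_of_forall_update _ i (measurableSet_remainingItems_lt i _ y) fun u => ?_
    have hS : (remainingItems u i).card = r + t * n := by
      rw [card_remainingItems]
      omega
    have h := pi_iterate_lt_le (D := D) hn (N := fun S => runTurns u (i + 1) S (n - 1))
      (fun S => runTurns_subset _ _ _ _) (fun S => card_runTurns _ _ _ _) y r t _ hS 1
    have h1 : D (Set.Iic 1) ^ (t * n) ≤ 1 := pow_le_one₀ (zero_le) prob_le_one
    refine le_trans (measure_mono_ae ?_) (h.trans (mul_le_of_le_one_right' h1))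
    filter_upwards [ae_pi_mem (ι := Fin m) (D := D) hD] with v hv hvu
    refine ⟨fun j _ => hv j, ?_⟩
    have h2 : ∀ k ∈ remainingItems (Function.update u i v) (t * n + i),
      Function.update u i v i k < y := hvu
    rwa [remainingItems_update, Function.update_self] at h2
  have hprod : (∏ s ∈ Finset.range t, ((r + (s + 1) * n : ℕ) / ((s + 1) * n : ℕ) : ENNReal)) ≤
      ENNReal.ofReal (Real.exp (t + r / n)) := by
    refine le_trans (le_of_eq ?_)
      (ENNReal.ofReal_le_ofReal (prod_one_add_div_le_exp t (ρ := r / n) (by positivity)))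
    rw [ENNReal.ofReal_prod_of_nonneg fun s _ => by positivity]
    refine Finset.prod_congr rfl fun s _ => ?_
    have h1 : (0 : ℝ) < ((s + 1) * n : ℕ) := by positivity
    rw [← ENNReal.ofReal_natCast (r + (s + 1) * n), ← ENNReal.ofReal_natCast ((s + 1) * n),
      ← ENNReal.ofReal_div_of_pos h1]
    congr 1
    push_cast
    field_simp
    ring
  have h := key.trans (mul_le_mul_left hprod _)
  refine ENNReal.toReal_le_of_le_ofReal (by positivity) (h.trans (le_of_eq ?_))
  rw [ENNReal.ofReal_mul (by positivity), ENNReal.ofReal_pow measureReal_nonneg,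
    ofReal_measureReal]

end Picks

/-! ### Distribution function of a PDF-bounded law -/

section Bounds

theorem IsPDFBoundedWith.real_eq {α β : ℝ} {D : Measure ℝ} (h : IsPDFBoundedWith α β D)
    (hα : 0 ≤ α) {a b : ℝ} (ha : 0 ≤ a) (hab : a ≤ b) (hb : b ≤ 1) :
    α * (b - a) ≤ D.real (Set.Ioc a b) ∧ D.real (Set.Ioc a b) ≤ β * (b - a) := by
  have := h.isProbabilityMeasure
  obtain ⟨f, -, -, hD, hf⟩ := h.exists_pdf
  have hsub : ∀ x ∈ Set.Ioc a b, x ∈ Set.Icc (0 : ℝ) 1 := fun x hx =>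
    ⟨ha.trans hx.1.le, hx.2.trans hb⟩
  have hβ : 0 ≤ β := hα.trans ((hf 0 ⟨le_rfl, zero_le_one⟩).1.trans (hf 0 ⟨le_rfl, zero_le_one⟩).2)
  have hDab : D (Set.Ioc a b) = ∫⁻ x in Set.Ioc a b, ENNReal.ofReal (f x) := by
    conv_lhs => rw [hD]
    rw [withDensity_apply _ measurableSet_Ioc]
  have hc : ∀ c : ℝ, 0 ≤ c → ∫⁻ _ in Set.Ioc a b, ENNReal.ofReal c =
      ENNReal.ofReal (c * (b - a)) := fun c hc => by
    rw [setLIntegral_const, Real.volume_Ioc, ENNReal.ofReal_mul hc]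
  constructor
  · rw [measureReal_def, ← ENNReal.ofReal_le_iff_le_toReal (measure_ne_top _ _), hDab, ← hc α hα]
    exact setLIntegral_mono' measurableSet_Ioc fun x hx =>
      ENNReal.ofReal_le_ofReal (hf x (hsub x hx)).1
  · refine ENNReal.toReal_le_of_le_ofReal (mul_nonneg hβ (sub_nonneg.2 hab)) ?_
    rw [hDab, ← hc β hβ]
    exact setLIntegral_mono' measurableSet_Ioc fun x hx =>
      ENNReal.ofReal_le_ofReal (hf x (hsub x hx)).2

theorem IsPDFBoundedWith.nullSingletonClass {α β : ℝ} {D : Measure ℝ}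
    (h : IsPDFBoundedWith α β D) : NullSingletonClass D := by
  obtain ⟨f, -, -, hD, -⟩ := h.exists_pdf
  rw [hD]
  infer_instance

/-- The first bound serves the small threshold η of an extra pick, the second the threshold 1 - δ of
good picks. -/
theorem IsPDFBoundedWith.real_Iic_le {α β : ℝ} {D : Measure ℝ} (h : IsPDFBoundedWith α β D)
    (hα : 0 ≤ α) {x : ℝ} (hx0 : 0 ≤ x) (hx1 : x ≤ 1) :
    D.real (Set.Iic x) ≤ β * x ∧ D.real (Set.Iic x) ≤ 1 - α * (1 - x) := by
  have := h.isProbabilityMeasure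
  have := h.nullSingletonClass
  constructor
  · refine le_trans ?_ ((h.real_eq hα le_rfl hx0 hx1).2.trans_eq (by rw [sub_zero]))
    refine ENNReal.toReal_mono (measure_ne_top _ _) ?_
    have h0 : D (Set.Iic 0) = 0 := by
      have hIio : D (Set.Iio 0) = 0 := measure_mono_null (t := (Set.Icc 0 1)ᶜ)
        (fun y (hy : y < 0) hy' => absurd hy'.1 (not_le.2 hy)) h.supported
      rw [← Set.Iio_union_right]
      exact measure_union_null hIio (measure_singleton 0)
    calc D (Set.Iic x) ≤ D (Set.Iic 0 ∪ Set.Ioc 0 x) := by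
          refine measure_mono fun y hy => ?_
          rcases le_or_gt y 0 with hy0 | hy0
          · exact Or.inl hy0
          · exact Or.inr ⟨hy0, hy⟩
      _ ≤ D (Set.Iic 0) + D (Set.Ioc 0 x) := measure_union_le _ _
      _ = D (Set.Ioc 0 x) := by rw [h0, zero_add]
  · have h1 := (h.real_eq hα hx0 hx1 le_rfl).1
    have hd : Disjoint (Set.Iic x) (Set.Ioc x 1) :=
      Set.disjoint_left.2 fun y hy hy' => absurd hy'.1 (not_lt.2 hy)
    have h2 : D.real (Set.Iic x) + D.real (Set.Ioc x 1) ≤ 1 := by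
      rw [← measureReal_union hd measurableSet_Ioc]
      exact measureReal_le_one
    linarith

end Bounds

/-! ### Union bound over the agents -/

section Failure

variable {D : Measure ℝ} [IsProbabilityMeasure D] {n m : ℕ}

/-- Hoeffding's inequality: centered variables with values in an interval of length 1 are
sub-Gaussian with parameter 1/4. -/
theorem utilityLaw_le_sum_le (hD : D (Set.Icc 0 1)ᶜ = 0) (hmean : ∫ x, x ∂D ≤ 1 / 2) (hm : 0 < m)
    (i : Fin n) {δ : ℝ} (hδ : 0 ≤ δ) :
    (utilityLaw D n m).real {u | m * (1 / 2 + δ) ≤ ∑ j, u i j} ≤ Real.exp (-2 * δ ^ 2 * m) := by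
  have hm' : (0 : ℝ) < m := by exact_mod_cast hm
  have hms : MeasurableSet {v : Fin m → ℝ | m * (1 / 2 + δ) ≤ ∑ j, v j} :=
    measurableSet_le measurable_const (Finset.measurable_sum _ fun j _ => measurable_pi_apply j)
  have h1 : (utilityLaw D n m).real {u | m * (1 / 2 + δ) ≤ ∑ j, u i j} =
      (Measure.pi fun _ : Fin m => D).real {v | m * (1 / 2 + δ) ≤ ∑ j, v j} :=
    (measurePreserving_eval (fun _ : Fin n => Measure.pi fun _ : Fin m => D) i).measureReal_preimage
      hms.nullMeasurableSet
  have hind : ProbabilityTheory.iIndepFun (fun (j : Fin m) (v : Fin m → ℝ) => v j - ∫ x, x ∂D)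
      (Measure.pi fun _ : Fin m => D) :=
    ProbabilityTheory.iIndepFun_pi (X := fun (_ : Fin m) (x : ℝ) => x - ∫ x, x ∂D)
      fun _ => by fun_prop
  have hsub : ∀ j ∈ Finset.univ, ProbabilityTheory.HasSubgaussianMGF
      (fun (v : Fin m → ℝ) => v j - ∫ x, x ∂D) ((‖(1 : ℝ) - 0‖₊ / 2) ^ 2)
      (Measure.pi fun _ : Fin m => D) := by
    intro j _
    have hint : ∫ v, v j ∂(Measure.pi fun _ : Fin m => D) = ∫ x, x ∂D :=
      integral_comp_eval (μ := fun _ : Fin m => D) (f := fun x : ℝ => x) (by fun_prop)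
    rw [← hint]
    refine ProbabilityTheory.hasSubgaussianMGF_of_mem_Icc (measurable_pi_apply j).aemeasurable ?_
    filter_upwards [ae_pi_mem (ι := Fin m) hD] with v hv using hv j
  have h2 := ProbabilityTheory.HasSubgaussianMGF.measure_sum_ge_le_of_iIndepFun hind hsub
    (ε := m * δ) (by positivity)
  rw [h1]
  refine (measureReal_mono fun v hv => ?_).trans (h2.trans_eq ?_)
  · have hv' : m * (1 / 2 + δ) ≤ ∑ j, v j := hv
    have : (m : ℝ) * ∫ x, x ∂D ≤ m * (1 / 2) := by gcongr
    simp only [Set.mem_ofPred_eq, Finset.sum_sub_distrib, Finset.sum_const, Finset.card_univ,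
      Fintype.card_fin, nsmul_eq_mul]
    linarith
  · congr 1
    simp
    field_simp

variable [NeZero n]

/-- The event that round-robin outputs a proportional allocation. -/
def proportionalEvent (n m : ℕ) [NeZero n] : Set (Fin n → Fin m → ℝ) :=
  {u | IsAllocation (roundRobin u) ∧ IsProportional u (roundRobin u)}

/-- An agent can be dissatisfied only if her total is unusually large (`H i`) or her bundle
unusually poor (`B i`). -/
theorem one_sub_sum_le_proportionalEvent (hD : D (Set.Icc 0 1)ᶜ = 0)
    (hmean : ∫ x, x ∂D ≤ 1 / 2) (hm : 0 < m) {δ : ℝ} (hδ : 0 ≤ δ)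
    (B : Fin n → Set (Fin n → Fin m → ℝ))
    (hB : ∀ u : Fin n → Fin m → ℝ, (∀ i j, 0 ≤ u i j) → ∀ i, u ∉ B i →
      m / n * (1 / 2 + δ) ≤ ∑ j ∈ roundRobin u i, u i j) :
    1 - ∑ i, (Real.exp (-2 * δ ^ 2 * m) + (utilityLaw D n m).real (B i)) ≤
      (utilityLaw D n m).real (proportionalEvent n m) := by
  have hn : (0 : ℝ) < n := by exact_mod_cast NeZero.pos n
  let H : Fin n → Set (Fin n → Fin m → ℝ) := fun i => {u | m * (1 / 2 + δ) ≤ ∑ j, u i j}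
  have hcover : (1 : ℝ) ≤ (utilityLaw D n m).real (proportionalEvent n m ∪ ⋃ i, (H i ∪ B i)) := by
    rw [← probReal_univ (μ := utilityLaw D n m)]
    refine ENNReal.toReal_mono (measure_ne_top _ _) (measure_mono_ae ?_)
    filter_upwards [ae_utilityLaw_mem (n := n) (m := m) hD] with u hu _
    by_cases h : ∃ i, u ∈ H i ∪ B i
    · exact Or.inr (Set.mem_iUnion.2 h)
    · push Not at h
      refine Or.inl ⟨isAllocation_roundRobin u, fun i => ?_⟩
      have h1 := hB u (fun i j => (hu i j).1) i fun hb => h i (Or.inr hb)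
      have h2 : ∑ j, u i j < m * (1 / 2 + δ) := not_le.1 fun hh => h i (Or.inl hh)
      refine le_trans ?_ h1
      rw [div_mul_eq_mul_div]
      gcongr
  have h1 := measureReal_union_le (μ := utilityLaw D n m) (proportionalEvent n m)
    (⋃ i, (H i ∪ B i))
  have h2 : (utilityLaw D n m).real (⋃ i, (H i ∪ B i)) ≤
      ∑ i, (Real.exp (-2 * δ ^ 2 * m) + (utilityLaw D n m).real (B i)) := by
    refine (measureReal_iUnion_fintype_le _).trans (Finset.sum_le_sum fun i _ => ?_)
    refine (measureReal_union_le _ _).trans (add_le_add_left ?_ _)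
    exact utilityLaw_le_sum_le hD hmean hm i hδ
  linarith

variable [NullSingletonClass D]

theorem one_sub_le_proportionalEvent_of_pick (hD : D (Set.Icc 0 1)ᶜ = 0)
    (hmean : ∫ x, x ∂D ≤ 1 / 2) {δ : ℝ} (hδ : 0 ≤ δ) {t : ℕ} (ht : (t + 1) * n ≤ m)
    {y : ℝ} (hy : m / n * (1 / 2 + δ) ≤ (t + 1) * y) :
    1 - ∑ i : Fin n, (Real.exp (-2 * δ ^ 2 * m) +
        Real.exp (t + (m - (t * n + i) : ℕ) / n) * D.real (Set.Iic y) ^ (m - (t * n + i))) ≤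
      (utilityLaw D n m).real (proportionalEvent n m) := by
  have hn := NeZero.pos n
  have hD1 : D (Set.Iic 1)ᶜ = 0 :=
    measure_mono_null (Set.compl_subset_compl.2 fun x hx => hx.2) hD
  have hlt : ∀ i : Fin n, t * n + i < m := fun i => by
    have := i.isLt
    have h2 : (t + 1) * n = t * n + n := by ring
    omega
  refine le_trans (sub_le_sub_left (Finset.sum_le_sum fun i _ => add_le_add_right ?_ _) _)
    (one_sub_sum_le_proportionalEvent hD hmean
      ((Nat.zero_le _).trans_lt (hlt ⟨0, hn⟩)) hδ
      (fun i => {u | ∀ k ∈ remainingItems u (t * n + i), u i k < y}) fun u hu i hi => ?_)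
  · exact utilityLaw_remainingItems_lt_le hD1 i t _ (by have := hlt i; omega) y
  · refine hy.trans (mul_le_sum_roundRobin u i (hu i) (hlt i) ?_)
    by_contra h
    push Not at h
    exact hi h

theorem one_sub_le_proportionalEvent_of_two_picks (hD : D (Set.Icc 0 1)ᶜ = 0)
    (hmean : ∫ x, x ∂D ≤ 1 / 2) {δ : ℝ} (hδ : 0 ≤ δ) {t : ℕ} (ht : (t + 2) * n ≤ m)
    {y z : ℝ} (hy : m / n * (1 / 2 + δ) ≤ (t + 1) * y + z) :
    1 - ∑ i : Fin n, (Real.exp (-2 * δ ^ 2 * m) +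
        (Real.exp (t + (m - (t * n + i) : ℕ) / n) * D.real (Set.Iic y) ^ (m - (t * n + i)) +
        Real.exp ((t + 1 : ℕ) + (m - ((t + 1) * n + i) : ℕ) / n) *
          D.real (Set.Iic z) ^ (m - ((t + 1) * n + i)))) ≤
      (utilityLaw D n m).real (proportionalEvent n m) := by
  have hn := NeZero.pos n
  have hD1 : D (Set.Iic 1)ᶜ = 0 :=
    measure_mono_null (Set.compl_subset_compl.2 fun x hx => hx.2) hD
  have hlt : ∀ i : Fin n, (t + 1) * n + i < m ∧ t * n + i < m := fun i => by
    have := i.isLt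
    have h2 : (t + 1) * n = t * n + n := by ring
    have h3 : (t + 2) * n = t * n + n + n := by ring
    omega
  refine le_trans (sub_le_sub_left (Finset.sum_le_sum fun i _ => add_le_add_right ?_ _) _)
    (one_sub_sum_le_proportionalEvent hD hmean
      ((Nat.zero_le _).trans_lt (hlt ⟨0, hn⟩).1) hδ
      (fun i => {u | ∀ k ∈ remainingItems u (t * n + i), u i k < y} ∪
        {u | ∀ k ∈ remainingItems u ((t + 1) * n + i), u i k < z}) fun u hu i hi => ?_)
  · refine (measureReal_union_le _ _).trans (add_le_add ?_ ?_)
    · exact utilityLaw_remainingItems_lt_le hD1 i t _ (by have := hlt i; omega) y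
    · exact utilityLaw_remainingItems_lt_le hD1 i (t + 1) _ (by have := hlt i; omega) z
  · refine hy.trans (mul_add_le_sum_roundRobin u i (hu i) (hlt i).1 ?_ ?_)
    · by_contra h
      push Not at h
      exact hi (Or.inl h)
    · by_contra h
      push Not at h
      exact hi (Or.inr h)

end Failure

/-! ### Choice of the turn and of the thresholds -/

section HighProbability

/-- Since F^r ≤ exp(-aδr) and t + r/n ≤ r(1/δ + 1)/n, large n lets half of the exponent aδr absorb t
+ r/n; the other half is at least aδ²n/2. -/
theorem exp_mul_pow_le_exp {F a δ : ℝ} (hF : 0 ≤ F) (hFa : F ≤ 1 - a * δ) (ha : 0 < a)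
    (hδ : 0 < δ) {t n r : ℕ} (hn : 0 < n) (hr : δ * n ≤ r) (ht : δ * (t * n) ≤ r)
    (hn' : (1 / δ + 1) / n ≤ a * δ / 2) :
    Real.exp (t + r / n) * F ^ r ≤ Real.exp (-(a * δ ^ 2 / 2) * n) := by
  have hn0 : (0 : ℝ) < n := by exact_mod_cast hn
  have h1 : F ^ r ≤ Real.exp (r * (-(a * δ))) := by
    rw [Real.exp_nat_mul]
    refine pow_le_pow_left₀ hF (hFa.trans ?_) r
    have := Real.add_one_le_exp (-(a * δ))
    linarith
  refine (mul_le_mul_of_nonneg_left h1 (Real.exp_pos _).le).trans ?_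
  rw [← Real.exp_add]
  refine Real.exp_le_exp.2 ?_
  have h2 : (t : ℝ) + r / n ≤ r * ((1 / δ + 1) / n) := by
    have h3 : (t : ℝ) ≤ r / (δ * n) := by
      rw [le_div_iff₀ (by positivity)]
      linarith
    have h4 : (r : ℝ) * ((1 / δ + 1) / n) = r / (δ * n) + r / n := by
      field_simp
    linarith
  have h5 : (r : ℝ) * ((1 / δ + 1) / n) ≤ r * (a * δ / 2) := by gcongr
  have h6 : a * δ / 2 * (δ * n) ≤ a * δ / 2 * r := by gcongr
  nlinarith

theorem sum_pow_sub_le {b : ℝ} (hb0 : 0 ≤ b) (hb : b ≤ 1 / 2) (n : ℕ) :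
    ∑ i : Fin n, b ^ (n - (i : ℕ)) ≤ 2 * b := by
  rw [Fin.sum_univ_eq_sum_range (fun i => b ^ (n - i)) n]
  have h1 : ∑ i ∈ Finset.range n, b ^ (n - i) = b * ∑ i ∈ Finset.range n, b ^ i := by
    rw [← Finset.sum_range_reflect, Finset.mul_sum]
    refine Finset.sum_congr rfl fun i hi => ?_
    rw [← pow_succ']
    congr 1
    have := Finset.mem_range.1 hi
    omega
  have h2 := mul_neg_geom_sum b n
  have h3 : 0 ≤ ∑ i ∈ Finset.range n, b ^ i := Finset.sum_nonneg fun i _ => pow_nonneg hb0 i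
  have h4 : 0 ≤ b ^ n := pow_nonneg hb0 n
  have h5 : ∑ i ∈ Finset.range n, b ^ i ≤ 2 := by nlinarith
  rw [h1]
  nlinarith

theorem eventually_mul_exp_neg_le {c ε : ℝ} (hc : 0 < c) (hε : 0 < ε) :
    ∀ᶠ n : ℕ in Filter.atTop, n * Real.exp (-c * n) ≤ ε := by
  have h := (tendsto_rpow_mul_exp_neg_mul_atTop_nhds_zero 1 c hc).comp
    (tendsto_natCast_atTop_atTop (R := ℝ))
  filter_upwards [h.eventually (ge_mem_nhds hε)] with n hn
  simpa using hn

/-- A turn `t` at which an agent's picks so far, each worth at least `1 - δ`, suffice for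
proportionality while many items still remain; or, if `m` is only slightly above `2 * n` or
`m < 4 * n`, such that a further pick worth `8 * δ` makes them suffice. -/
theorem exists_pick_index {n m : ℕ} (hn : 0 < n) (hm : 2 * n ≤ m) {δ : ℝ} (hδ0 : 0 < δ)
    (hδ1 : δ ≤ 1 / 16) :
    (∃ t : ℕ, (t + 1) * n ≤ m ∧
      (∀ i < n, δ * n ≤ (m - (t * n + i) : ℕ) ∧ δ * (t * n) ≤ (m - (t * n + i) : ℕ)) ∧
      (m : ℝ) / n * (1 / 2 + δ) ≤ (t + 1) * (1 - δ)) ∨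
    ∃ t : ℕ, t ≤ 1 ∧ (t + 2) * n ≤ m ∧ m ≤ (t + 3) * n ∧
      (m : ℝ) / n * (1 / 2 + δ) ≤ (t + 1) * (1 - δ) + 8 * δ := by
  have hn0 : (0 : ℝ) < n := by exact_mod_cast hn
  obtain ⟨q, s, hs, rfl⟩ : ∃ q s, s < n ∧ m = q * n + s :=
    ⟨m / n, m % n, Nat.mod_lt _ hn, (Nat.div_add_mod' m n).symm⟩
  have hs' : (s : ℝ) < n := by exact_mod_cast hs
  have hq2 : 2 ≤ q := by
    by_contra hq
    have : q * n ≤ 1 * n := Nat.mul_le_mul_right n (by omega)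
    omega
  have hdiv : ((q * n + s : ℕ) : ℝ) / n = q + s / n := by
    push_cast
    field_simp
  have hsn : (s : ℝ) / n < 1 := by rwa [div_lt_one hn0]
  -- For 2n ≤ m < 3n two good picks suffice when more than δn items remain before every second turn.
  -- Otherwise m/n ≤ 2 + δ, and one good pick plus 8δ is enough.
  rcases hq2.eq_or_lt with rfl | hq3
  · rcases le_or_gt (s : ℝ) (δ * n) with hsδ | hsδ
    · refine Or.inr ⟨0, by norm_num, by omega, by omega, ?_⟩
      have : (s : ℝ) / n ≤ δ := by rwa [div_le_iff₀ hn0]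
      rw [hdiv]
      push_cast
      nlinarith
    · refine Or.inl ⟨1, by omega, fun i hi => ?_, ?_⟩
      · have h1 : s ≤ 2 * n + s - (1 * n + i) := by
          omega
        have h2 : (s : ℝ) ≤ (2 * n + s - (1 * n + i) : ℕ) := by exact_mod_cast h1
        push_cast at h2 ⊢
        constructor <;> linarith
      · rw [hdiv]
        push_cast
        nlinarith
  rcases (Nat.succ_le_of_lt hq3).eq_or_lt with rfl | hq4
  · refine Or.inr ⟨1, le_rfl, by omega, by omega, ?_⟩
    rw [hdiv]
    push_cast
    nlinarith
  have hq4' : (4 : ℝ) ≤ q := by exact_mod_cast hq4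
  -- About a quarter of the rounds is sacrificed: kn items remain, at least a seventh of qn, while t
  -- + 1 ≥ 3q/4 good picks suffice. With δ = 1/16 the final estimate is 45q/64 ≥ 36(q + 1)/64, an
  -- equality at q = 4.
  obtain ⟨k, hk⟩ : ∃ k, k = q / 4 := ⟨_, rfl⟩
  have hk1 : 1 ≤ k := by omega
  have hkq : q ≤ 7 * k := by omega
  have hk4 : 4 * k ≤ q := by omega
  obtain ⟨t, ht⟩ : ∃ t, q = t + 1 + k := ⟨q - 1 - k, by omega⟩
  have hqn : q * n = t * n + n + k * n := by rw [ht]; ring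
  have htq : (t : ℝ) + 1 + k = q := by exact_mod_cast ht.symm
  have hk4' : (4 : ℝ) * k ≤ q := by exact_mod_cast hk4
  refine Or.inl ⟨t, ?_, fun i hi => ?_, ?_⟩
  · have : (t + 1) * n = t * n + n := by ring
    omega
  · have h1 : k * n ≤ q * n + s - (t * n + i) := by
      omega
    have h2 : (k : ℝ) * n ≤ (q * n + s - (t * n + i) : ℕ) := by exact_mod_cast h1
    have hk1' : (1 : ℝ) ≤ k := by exact_mod_cast hk1
    have hkq' : (q : ℝ) ≤ 7 * k := by exact_mod_cast hkq
    have h3 : δ ≤ k := by linarith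
    have h4 : δ * t ≤ k := by nlinarith
    refine ⟨(mul_le_mul_of_nonneg_right h3 hn0.le).trans h2, ?_⟩
    rw [← mul_assoc]
    exact (mul_le_mul_of_nonneg_right h4 hn0.le).trans h2
  · rw [hdiv]
    have h1 : (3 / 4 : ℝ) * q ≤ t + 1 := by linarith
    have h2 : (q + s / n) * (1 / 2 + δ) ≤ (q + 1) * (1 / 2 + 1 / 16 : ℝ) := by gcongr
    have h3 : (3 / 4 : ℝ) * q * (1 - 1 / 16) ≤ (t + 1) * (1 - δ) := by gcongr
    linarith

theorem eventually_one_sub_le_proportionalEvent {α β : ℝ} {D : Measure ℝ}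
    (h : IsPDFBoundedWith α β D) (hα : 0 < α) (hβ : 0 < β) (hmean : ∫ x, x ∂D ≤ 1 / 2) {ε : ℝ}
    (hε : 0 < ε) :
    ∃ n₀ : ℕ, ∀ (n : ℕ) [NeZero n], n₀ ≤ n → ∀ m : ℕ, 2 * n ≤ m →
      1 - ε ≤ (utilityLaw D n m).real (proportionalEvent n m) := by
  have := h.isProbabilityMeasure
  have := h.nullSingletonClass
  -- The error of the extra pick does not tend to 0 with n; it takes half of ε through the choice of
  -- η. The other two errors get ε/4 each. Below, δ = η/8 matches the extra pick 8δ of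
  -- `exists_pick_index`.
  obtain ⟨η, hη0, hη1, hη2, hη3⟩ : ∃ η : ℝ, 0 < η ∧ η ≤ 1 / 2 ∧ β * η ≤ 1 / 2 ∧
      Real.exp 4 * (2 * (β * η)) ≤ ε / 2 := by
    refine ⟨min (1 / 2) (min (1 / (2 * β)) (ε / (4 * β * Real.exp 4))), by positivity,
      min_le_left _ _, ?_, ?_⟩
    · have h1 := (min_le_right (1 / 2 : ℝ) _).trans
        (min_le_left (1 / (2 * β)) (ε / (4 * β * Real.exp 4)))
      refine (mul_le_mul_of_nonneg_left h1 hβ.le).trans_eq ?_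
      field_simp
    · have h1 := (min_le_right (1 / 2 : ℝ) _).trans
        (min_le_right (1 / (2 * β)) (ε / (4 * β * Real.exp 4)))
      refine (mul_le_mul_of_nonneg_left (mul_le_mul_of_nonneg_left
        (mul_le_mul_of_nonneg_left h1 hβ.le) zero_le_two) (Real.exp_pos 4).le).trans_eq ?_
      field_simp
      norm_num
  obtain ⟨δ, hδ⟩ : ∃ δ, δ = η / 8 := ⟨_, rfl⟩
  have hδ0 : 0 < δ := by rw [hδ]; positivity
  have hδ1 : δ ≤ 1 / 16 := by rw [hδ]; linarith
  have hFη := (h.real_Iic_le hα.le hη0.le (hη1.trans (by norm_num))).1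
  have hFδ := (h.real_Iic_le hα.le (x := 1 - δ) (by linarith) (by linarith)).2
  rw [sub_sub_cancel] at hFδ
  have hlim : ∀ᶠ n : ℕ in Filter.atTop, (1 / δ + 1) / n ≤ α * δ / 2 := by
    have h1 : Filter.Tendsto (fun n : ℕ => (1 / δ + 1) / (n : ℝ)) Filter.atTop (nhds 0) :=
      tendsto_const_div_atTop_nhds_zero_nat _
    exact h1.eventually (ge_mem_nhds (by positivity))
  obtain ⟨n₀, hn₀⟩ := Filter.eventually_atTop.1
    ((eventually_mul_exp_neg_le (c := 4 * δ ^ 2) (by positivity) (ε := ε / 4)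
      (by positivity)).and ((eventually_mul_exp_neg_le (c := α * δ ^ 2 / 2) (by positivity)
        (ε := ε / 4) (by positivity)).and hlim))
  refine ⟨n₀, fun n _ hn m hm => ?_⟩
  obtain ⟨hε1, hε2, hlim⟩ := hn₀ n hn
  have hnpos := NeZero.pos n
  have hn0 : (0 : ℝ) < n := by exact_mod_cast hnpos
  have hm' : (2 : ℝ) * n ≤ m := by exact_mod_cast hm
  have hexp : Real.exp (-2 * δ ^ 2 * m) ≤ Real.exp (-(4 * δ ^ 2) * n) := by
    refine Real.exp_le_exp.2 ?_
    nlinarith [sq_nonneg δ]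
  have strong : ∀ t : ℕ, (t + 1) * n ≤ m →
      (∀ i : Fin n, δ * n ≤ (m - (t * n + i) : ℕ) ∧ δ * (t * n) ≤ (m - (t * n + i) : ℕ)) →
      m / n * (1 / 2 + δ) ≤ (t + 1) * (1 - δ) →
      1 - ε ≤ (utilityLaw D n m).real (proportionalEvent n m) := by
    intro t ht hr hy
    refine le_trans (sub_le_sub_left ?_ _)
      (one_sub_le_proportionalEvent_of_pick h.supported hmean hδ0.le ht hy)
    calc _ ≤ ∑ i : Fin n, (Real.exp (-(4 * δ ^ 2) * n) + Real.exp (-(α * δ ^ 2 / 2) * n)) :=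
          Finset.sum_le_sum fun i _ => add_le_add hexp
            (exp_mul_pow_le_exp measureReal_nonneg hFδ hα hδ0 hnpos (hr i).1 (hr i).2 hlim)
      _ = n * Real.exp (-(4 * δ ^ 2) * n) + n * Real.exp (-(α * δ ^ 2 / 2) * n) := by
          simp
      _ ≤ ε := by linarith
  have weak : ∀ t : ℕ, t ≤ 1 → (t + 2) * n ≤ m → m ≤ (t + 3) * n →
      m / n * (1 / 2 + δ) ≤ (t + 1) * (1 - δ) + η →
      1 - ε ≤ (utilityLaw D n m).real (proportionalEvent n m) := by
    intro t ht1 ht ht' hy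
    refine le_trans (sub_le_sub_left ?_ _)
      (one_sub_le_proportionalEvent_of_two_picks h.supported hmean hδ0.le ht hy)
    have hr : ∀ i : Fin n, δ * n ≤ (m - (t * n + i) : ℕ) ∧ δ * (t * n) ≤ (m - (t * n + i) : ℕ) := by
      intro i
      have h1 : n ≤ m - (t * n + i) := by
        have := i.isLt
        have h3 : (t + 2) * n = t * n + n + n := by ring
        omega
      have h2 : (n : ℝ) ≤ (m - (t * n + i) : ℕ) := by exact_mod_cast h1
      have h3 : (t : ℝ) ≤ 1 := by exact_mod_cast ht1
      have h4 : δ * n ≤ n := by nlinarith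
      have h5 : t * (n : ℝ) ≤ n := by nlinarith
      exact ⟨h4.trans h2, (mul_le_mul_of_nonneg_left h5 hδ0.le).trans (h4.trans h2)⟩
    -- Between n - i and 2n items remain. The upper bound, with t + 1 ≤ 2, gives the constant exp 4;
    -- the lower one gives the geometric series.
    have hw : ∀ i : Fin n, Real.exp ((t + 1 : ℕ) + (m - ((t + 1) * n + i) : ℕ) / n) *
        D.real (Set.Iic η) ^ (m - ((t + 1) * n + i)) ≤ Real.exp 4 * (β * η) ^ (n - (i : ℕ)) := by
      intro i
      have h3 : (t + 2) * n = (t + 1) * n + n := by ring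
      have h4 : (t + 3) * n = (t + 1) * n + 2 * n := by ring
      have h5 : m - ((t + 1) * n + i) ≤ 2 * n := by omega
      have h6 : ((m - ((t + 1) * n + i) : ℕ) : ℝ) ≤ 2 * n := by exact_mod_cast h5
      refine mul_le_mul (Real.exp_le_exp.2 ?_) ?_ (pow_nonneg measureReal_nonneg _)
        (Real.exp_pos _).le
      · have h7 : ((m - ((t + 1) * n + i) : ℕ) : ℝ) / n ≤ 2 := by rwa [div_le_iff₀ hn0]
        have h8 : ((t + 1 : ℕ) : ℝ) ≤ 2 := by exact_mod_cast Nat.succ_le_succ ht1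
        linarith
      · refine (pow_le_pow_left₀ measureReal_nonneg hFη _).trans
          (pow_le_pow_of_le_one (by positivity) (by linarith) ?_)
        omega
    calc _ ≤ ∑ i : Fin n, (Real.exp (-(4 * δ ^ 2) * n) + (Real.exp (-(α * δ ^ 2 / 2) * n) +
            Real.exp 4 * (β * η) ^ (n - (i : ℕ)))) :=
          Finset.sum_le_sum fun i _ => add_le_add hexp (add_le_add
            (exp_mul_pow_le_exp measureReal_nonneg hFδ hα hδ0 hnpos (hr i).1 (hr i).2 hlim) (hw i))
      _ = n * Real.exp (-(4 * δ ^ 2) * n) + (n * Real.exp (-(α * δ ^ 2 / 2) * n) +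
            Real.exp 4 * ∑ i : Fin n, (β * η) ^ (n - (i : ℕ))) := by
          simp [Finset.sum_add_distrib, Finset.mul_sum]
      _ ≤ n * Real.exp (-(4 * δ ^ 2) * n) + (n * Real.exp (-(α * δ ^ 2 / 2) * n) +
            Real.exp 4 * (2 * (β * η))) := by
          gcongr
          exact sum_pow_sub_le (by positivity) hη2 n
      _ ≤ ε := by linarith
  rcases exists_pick_index hnpos hm hδ0 hδ1 with ⟨t, ht, hr, hy⟩ | ⟨t, ht1, ht, ht', hy⟩
  · exact strong t ht (fun i => hr i i.isLt) hy
  · exact weak t ht1 ht ht' (hy.trans_eq (by rw [hδ]; ring))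

end HighProbability

/-! ### The uniform distribution and tightness -/

section Uniform

instance isProbabilityMeasure_uniform01 : IsProbabilityMeasure uniform01 :=
  ⟨by simp [uniform01]⟩

theorem uniform01_compl_Icc : uniform01 (Set.Icc 0 1)ᶜ = 0 := by
  rw [uniform01, Measure.restrict_apply measurableSet_Icc.compl]
  simp

theorem isPDFBounded_uniform01 : IsPDFBounded uniform01 := by
  refine ⟨1, 1, one_pos, one_pos, ⟨inferInstance, uniform01_compl_Icc,
    (Set.Icc (0 : ℝ) 1).indicator 1, measurable_one.indicator measurableSet_Icc,
    fun x => Set.indicator_nonneg (fun _ _ => zero_le_one) x, ?_, fun x hx => by simp [hx]⟩⟩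
  rw [uniform01, ← withDensity_indicator_one measurableSet_Icc]
  congr 1
  ext x
  by_cases hx : x ∈ Set.Icc (0 : ℝ) 1
  · simp only [Set.indicator_of_mem hx, Pi.one_apply, ENNReal.ofReal_one]
  · simp only [Set.indicator_of_notMem hx, ENNReal.ofReal_zero]

theorem integral_uniform01 : ∫ x, x ∂uniform01 = 1 / 2 := by
  rw [uniform01, integral_Icc_eq_integral_Ioc, ← intervalIntegral.integral_of_le zero_le_one,
    integral_id]
  norm_num

theorem uniform01_real_Ioi : uniform01.real (Set.Ioi (3 / 4)) = 1 / 4 := by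
  have h : Set.Ioi (3 / 4 : ℝ) ∩ Set.Icc 0 1 = Set.Ioc (3 / 4) 1 := by
    ext x
    simp only [Set.mem_inter_iff, Set.mem_Ioi, Set.mem_Icc, Set.mem_Ioc]
    constructor
    · exact fun h => ⟨h.1, h.2.2⟩
    · exact fun h => ⟨h.1, by linarith [h.1], h.2⟩
  rw [uniform01, measureReal_restrict_apply measurableSet_Ioi, h, Real.volume_real_Ioc]
  norm_num

theorem measurePreserving_one_sub_uniform01 :
    MeasurePreserving (fun x : ℝ => 1 - x) uniform01 uniform01 := by
  have h := (Measure.measurePreserving_sub_left (volume : Measure ℝ) 1).restrict_preimage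
    (measurableSet_Icc (a := (0 : ℝ)) (b := 1))
  rwa [Set.preimage_const_sub_Icc, sub_self, sub_zero] at h

/-- By the symmetry x ↦ 1 - x: of v and 1 - v, at least one lies in the event, and both have the
same law. -/
theorem half_le_pi_uniform01_sum {ι : Type*} [Fintype ι] (T : Finset ι) :
    1 / 2 ≤ (Measure.pi fun _ : ι => uniform01).real
      {v | (T.card : ℝ) / 2 ≤ ∑ k ∈ T, v k} := by
  have hm : MeasurableSet {v : ι → ℝ | (T.card : ℝ) / 2 ≤ ∑ k ∈ T, v k} :=
    measurableSet_le measurable_const (Finset.measurable_sum _ fun j _ => measurable_pi_apply j)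
  have hf := measurePreserving_pi (fun _ : ι => uniform01) (fun _ : ι => uniform01)
    (fun _ => measurePreserving_one_sub_uniform01)
  have h1 := hf.measureReal_preimage hm.nullMeasurableSet
  have h2 : (Set.univ : Set (ι → ℝ)) ⊆ {v : ι → ℝ | (T.card : ℝ) / 2 ≤ ∑ k ∈ T, v k} ∪
      (fun (v : ι → ℝ) i => 1 - v i) ⁻¹' {v : ι → ℝ | (T.card : ℝ) / 2 ≤ ∑ k ∈ T, v k} := by
    intro v _
    rcases le_total ((T.card : ℝ) / 2) (∑ k ∈ T, v k) with h | h
    · exact Or.inl h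
    · refine Or.inr ?_
      simp only [Set.mem_preimage, Set.mem_ofPred_eq, Finset.sum_sub_distrib, Finset.sum_const,
        nsmul_eq_mul, mul_one]
      linarith
  have h3 := (measureReal_mono (μ := Measure.pi fun _ : ι => uniform01) h2).trans
    (measureReal_union_le _ _)
  rw [h1, probReal_univ] at h3
  linarith

/-- Two items exceed 3/4 with probability 1/16, and independently the other 2n - 3 sum to at least
half their number with probability at least 1/2; then the total exceeds 3/2 + (2n - 3)/2 = n. -/
theorem pi_uniform01_lt_sum (n : ℕ) (hn : 2 ≤ n) :
    1 / 32 ≤ (Measure.pi fun _ : Fin (2 * n - 1) => uniform01).real {v | (n : ℝ) < ∑ j, v j} := by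
  let a : Fin (2 * n - 1) := ⟨0, by omega⟩
  let b : Fin (2 * n - 1) := ⟨1, by omega⟩
  let T : Finset (Fin (2 * n - 1)) := {a, b}
  have hT : T.card = 2 := Finset.card_pair (by simp [a, b, Fin.ext_iff])
  have hTc : (Tᶜ.card : ℝ) = 2 * n - 3 := by
    rw [Finset.card_compl, hT, Fintype.card_fin]
    have : 2 * n - 1 - 2 + 3 = 2 * n := by omega
    have h' : ((2 * n - 1 - 2 : ℕ) : ℝ) + 3 = 2 * n := by exact_mod_cast this
    linarith
  let P : Set (Fin (2 * n - 1) → ℝ) := {v | (Tᶜ.card : ℝ) / 2 ≤ ∑ k ∈ Tᶜ, v k}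
  have hP : MeasurableSet P :=
    measurableSet_le measurable_const (Finset.measurable_sum _ fun j _ => measurable_pi_apply j)
  have h := pi_forall_mem_and (D := uniform01) (measurableSet_Ioi (a := (3 / 4 : ℝ))) T hP
    fun k hk v z => by
      have : ∑ l ∈ Tᶜ, Function.update v k z l = ∑ l ∈ Tᶜ, v l :=
        Finset.sum_congr rfl fun l hl => Function.update_of_ne
          (ne_of_mem_of_not_mem hk (Finset.mem_compl.1 hl)).symm _ _
      simp only [P, Set.mem_ofPred_eq, this]
  have h' := congrArg ENNReal.toReal h
  rw [ENNReal.toReal_mul, ENNReal.toReal_pow, hT] at h'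
  have hhalf : 1 / 2 ≤ (Measure.pi fun _ : Fin (2 * n - 1) => uniform01).real P :=
    half_le_pi_uniform01_sum _
  have hq := uniform01_real_Ioi
  rw [measureReal_def] at hq hhalf
  rw [hq] at h'
  refine le_trans ?_ (measureReal_mono (s₁ := {v | (∀ k ∈ T, v k ∈ Set.Ioi (3 / 4 : ℝ)) ∧ v ∈ P})
    fun v hv => ?_)
  · rw [measureReal_def, h']
    linarith
  · obtain ⟨h1, h2⟩ := hv
    have h3 : (Tᶜ.card : ℝ) / 2 ≤ ∑ k ∈ Tᶜ, v k := h2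
    have h4 : (3 / 4 : ℝ) < v a := h1 a (by simp [T])
    have h5 : (3 / 4 : ℝ) < v b := h1 b (by simp [T])
    have h6 : ∑ k ∈ T, v k = v a + v b := Finset.sum_pair (by simp [a, b, Fin.ext_iff])
    rw [hTc] at h3
    rw [Set.mem_ofPred_eq, ← Finset.sum_add_sum_compl T, h6]
    linarith

theorem not_isProportional_of_lt_sum {n : ℕ} [NeZero n] (u : Fin n → Fin (2 * n - 1) → ℝ)
    (i : Fin n) (hi : (i : ℕ) = n - 1) (hu : ∀ j, u i j ≤ 1) (h : (n : ℝ) < ∑ j, u i j) :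
    ¬ IsProportional u (roundRobin u) := by
  intro hp
  have hn : (0 : ℝ) < n := by exact_mod_cast NeZero.pos n
  have h1 : 1 < (∑ j, u i j) / (n : ℝ) := (one_lt_div hn).2 h
  have h2 : ∑ j ∈ roundRobin u i, u i j ≤ (roundRobin u i).card • (1 : ℝ) :=
    Finset.sum_le_card_nsmul _ _ _ fun j _ => hu j
  have h3 : ((roundRobin u i).card : ℝ) ≤ 1 := by exact_mod_cast card_roundRobin_last_le u i hi
  have h4 := hp i
  rw [nsmul_eq_mul, mul_one] at h2
  linarith

theorem le_utilityLaw_not_isProportional (n : ℕ) [NeZero n] (hn : 2 ≤ n) :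
    1 / 32 ≤ (utilityLaw uniform01 n (2 * n - 1)).real
      {u | ¬ IsProportional u (roundRobin u)} := by
  let i : Fin n := ⟨n - 1, by omega⟩
  have hm : MeasurableSet {v : Fin (2 * n - 1) → ℝ | (n : ℝ) < ∑ j, v j} :=
    measurableSet_lt measurable_const (Finset.measurable_sum _ fun j _ => measurable_pi_apply j)
  have h1 : (utilityLaw uniform01 n (2 * n - 1)).real {u | (n : ℝ) < ∑ j, u i j} =
      (Measure.pi fun _ : Fin (2 * n - 1) => uniform01).real {v | (n : ℝ) < ∑ j, v j} :=
    (measurePreserving_eval (fun _ : Fin n => Measure.pi fun _ : Fin (2 * n - 1) => uniform01)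
      i).measureReal_preimage hm.nullMeasurableSet
  refine (pi_uniform01_lt_sum n hn).trans (h1.symm.trans_le ?_)
  refine ENNReal.toReal_mono (measure_ne_top _ _) (measure_mono_ae ?_)
  filter_upwards [ae_utilityLaw_mem (n := n) (m := 2 * n - 1) uniform01_compl_Icc] with u hu h
  exact not_isProportional_of_lt_sum u i rfl (fun j => (hu i j).2) h

end Uniform

end FairDivision

theorem theorem4p2 :
    -- Round-robin is proportional with high probability, uniformly over all `m ≥ 2n`.
    (∀ D : Measure ℝ, FairDivision.IsPDFBounded D → ∫ x, x ∂D ≤ 1 / 2 →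
      ∀ ε : ℝ, 0 < ε → ∃ n₀ : ℕ, ∀ (n : ℕ) [NeZero n], n₀ ≤ n → ∀ m : ℕ, 2 * n ≤ m →
        1 - ε ≤ (FairDivision.utilityLaw D n m).real
          {u | FairDivision.IsAllocation (FairDivision.roundRobin u) ∧
            FairDivision.IsProportional u (FairDivision.roundRobin u)}) ∧
    -- The uniform distribution on `[0, 1]` is covered by the first part.
    (FairDivision.IsPDFBounded FairDivision.uniform01 ∧
      ∫ x, x ∂FairDivision.uniform01 = 1 / 2) ∧
    -- Tightness: for `U[0,1]` and `m = 2n - 1`, failure has at least a constant probability.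
    (∃ c : ℝ, 0 < c ∧ ∀ (n : ℕ) [NeZero n], 2 ≤ n →
      c ≤ (FairDivision.utilityLaw FairDivision.uniform01 n (2 * n - 1)).real
        {u | ¬ FairDivision.IsProportional u (FairDivision.roundRobin u)}) := by
  refine ⟨fun D ⟨α, β, hα, hβ, h⟩ hmean ε hε =>
    FairDivision.eventually_one_sub_le_proportionalEvent h hα hβ hmean hε,
    ⟨FairDivision.isPDFBounded_uniform01, FairDivision.integral_uniform01⟩,
    1 / 32, by norm_num, fun n _ hn => FairDivision.le_utilityLaw_not_isProportional n hn⟩
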